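/- Setting. Let $\Lambda\subset\mathbb Z^d$ be finite, with a Hilbert space $\mathbb C^{N_u}$ at each site $u\in\Lambda$; operators act on $\bigotimes_{u\in\Lambda}\mathbb C^{N_u}$ and $\|\cdot\|$ is the operator norm. Let $d(u,v)\in\{0,1,\dots,\infty\}$ be the graph distance in the nearest-neighbour graph of $\Lambda$ (for a box, the $\ell^1$-distance), and $b_u(r)=\{v\in\Lambda:d(u,v)\le r\}$. Let $H(s)=\sum_{u\in\Lambda}Q_u+\sum_{u\in\Lambda}V_u(s)$, $s\in[0,1]$, with Hermitian $Q_u$, $V_u(s)$ supported on $b_u(r_0)$, $\|Q_u\|\le J_1$, $\|V_u(s)\|\le J_1$, $V_u(0)=0$, $V_u$ differentiable with $\|\partial_sV_u(s)\|\le J_2$; assume that every $H(s)$ has a unique ground state $\psi_0(s)$, differentiable in $s$, with spectral gap at least $\gamma>0$. Let $f_\gamma:[0,\infty)\to(0,1]$ be a sub-exponentially decaying function: it is non-increasing, $f_\gamma(0)=1$, $\lim_{r\to\infty}e^{r^\alpha}f_\gamma(r)=0$ for every $\alpha\in(0,1)$, and $\log f_\gamma$ is convex on some half-line $[r_1,\infty)$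 (for instance $f_\gamma(r)=\exp(-c\,r/\ln^2 r)$ for large $r$, with $c>0$). Let $U_s$, $s\in[0,1]$, be a quasi-adiabatic evolution along $H(s)$, that is, unitaries with $\psi_0(s)=U_s\psi_0(0)$, $\partial_sU_s=i\mathcal D_sU_s$, $U_0=\mathbb 1$, where $\mathcal D_s=\sum_{u\in\Lambda}\sum_{r\ge r_0}\mathcal D_s(u;r)$ with $\mathcal D_s(u;r)$ Hermitian, continuous in $s$, supported on $b_u(r)$, and $\|\mathcal D_s(u;r)\|\le 2J_2f_\gamma(r-r_0)$. For $A\subset\Lambda$ and $A^c=\Lambda\setminus A$ let $\partial A$ be the set of sites of $A$ with a nearest neighbour in $A^c$, and for $R\in\mathbb N$ let $I_A(R)=\{x\in A:d(x,\partial A)\le R\}$, $E_A(R)=\{x\in A^c:d(x,\partial A)\le R\}$, $\partial A(R)=I_A(R)\cup E_A(R)$ (with $d(x,\emptyset)=\infty$). Lemma. There are constants $c_1,c_2,c_3>0$, where $c_3$ depends only on $d$, and $c_1,c_2$ depend only on $d$, $r_0$, $\gamma$ and the function $f_\gamma$, such that the following holds for all $\Lambda$, $(N_u)$, $J_1$,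 $J_2$, $H(\cdot)$, $U_\cdot$ as above, all $A\subset\Lambda$ and all $s\in[0,1]$. There exist unitaries $U_s(A)$ and $U_s(A^c)$, supported on $A$ and $A^c$ respectively, and for every $R\in\mathbb N$ a unitary $U_s(\partial A(2R))$ supported on $\partial A(2R)$, such that $$\big\|U_s(A)\otimes U_s(A^c)\,U_s(\partial A(2R))-U_s\big\|\le c_1\Big(e^{c_2(J_2/\gamma)|s|}-1\Big)\,|\partial A|\,f_\gamma(c_3R).$$ -/

import Mathlib

open Set Filter Topology
open scoped Matrix Matrix.Norms.L2Operator

noncomputable section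

/-! ### Lattice geometry -/

/-- The nearest-neighbour graph of `ℤ^d`: sites at `ℓ¹`-distance one are adjacent. -/
def latticeGraph (d : ℕ) : SimpleGraph (Fin d → ℤ) where
  Adj x y := ∑ i, |x i - y i| = 1
  symm := ⟨fun x y h => by
    rw [← h]
    exact Finset.sum_congr rfl fun i _ => abs_sub_comm _ _⟩
  loopless := ⟨fun x h => by simp at h⟩

/-- The nearest-neighbour graph of a finite lattice `Λ ⊂ ℤ^d`. -/
abbrev siteGraph {d : ℕ} (Λ : Finset (Fin d → ℤ)) : SimpleGraph Λ :=
  (latticeGraph d).comap Subtype.val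

/-- The lattice distance `d(u,v)`: the length of a shortest nearest-neighbour path in `Λ`
(`⊤` if there is none). -/
def latDist {d : ℕ} {Λ : Finset (Fin d → ℤ)} (u v : Λ) : ℕ∞ := (siteGraph Λ).edist u v

/-- The distance `d(x,Y)` of a site to a set of sites (`⊤` if `Y` is empty). -/
def latDistSet {d : ℕ} {Λ : Finset (Fin d → ℤ)} (x : Λ) (Y : Set Λ) : ℕ∞ :=
  ⨅ y ∈ Y, latDist x y

/-- The ball `b_u(r)`. -/
def latBall {d : ℕ} {Λ : Finset (Fin d → ℤ)} (u : Λ) (r : ℕ) : Set Λ :=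
  {v | latDist u v ≤ r}

/-- The boundary `∂A`: the sites of `A` which have a nearest neighbour in `Aᶜ = Λ \ A`. -/
def bdry {d : ℕ} {Λ : Finset (Fin d → ℤ)} (A : Set Λ) : Set Λ :=
  {x | x ∈ A ∧ ∃ y, y ∉ A ∧ (siteGraph Λ).Adj x y}

/-- `I_A(R)`. -/
def innerStrip {d : ℕ} {Λ : Finset (Fin d → ℤ)} (A : Set Λ) (R : ℕ) : Set Λ :=
  {x | x ∈ A ∧ latDistSet x (bdry A) ≤ R}

/-- `E_A(R)`. -/
def outerStrip {d : ℕ} {Λ : Finset (Fin d → ℤ)} (A : Set Λ) (R : ℕ) : Set Λ :=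
  {x | x ∈ Aᶜ ∧ latDistSet x (bdry A) ≤ R}

/-- `∂A(R) = I_A(R) ∪ E_A(R)`. -/
def bdryStrip {d : ℕ} {Λ : Finset (Fin d → ℤ)} (A : Set Λ) (R : ℕ) : Set Λ :=
  innerStrip A R ∪ outerStrip A R

/-! ### Operators on the spin system

The site `u` carries the Hilbert space `ℂ^(N u)`.  The Hilbert space of a set of sites is the
tensor product, with the orthonormal product basis labelled by configurations. -/

/-- Basis labels of the Hilbert space `⨂_{u ∈ Λ} ℂ^(N u)`. -/
abbrev Config {d : ℕ} {Λ : Finset (Fin d → ℤ)} (N : Λ → ℕ) : Type := (u : Λ) → Fin (N u)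

/-- Operators on `⨂_{u ∈ Λ} ℂ^(N u)`, written in the product basis; the norm is the operator
norm of the Euclidean norm. -/
abbrev Op {d : ℕ} {Λ : Finset (Fin d → ℤ)} (N : Λ → ℕ) : Type :=
  Matrix (Config N) (Config N) ℂ

open Classical in
/-- For an operator `B` on `⨂_{u ∈ X} ℂ^(N u)`, the operator `B ⊗ 𝟙` on the whole system. -/
def extendOp {d : ℕ} {Λ : Finset (Fin d → ℤ)} {N : Λ → ℕ} (X : Set Λ)
    (B : Matrix ((u : X) → Fin (N u)) ((u : X) → Fin (N u)) ℂ) : Op N :=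
  Matrix.of fun x y =>
    if ∀ u, u ∉ X → x u = y u then B (fun u => x u) (fun u => y u) else 0

/-- The operator `M` is supported on `X`: it acts as the identity outside of `X`. -/
def SupportedOn {d : ℕ} {Λ : Finset (Fin d → ℤ)} {N : Λ → ℕ} (X : Set Λ) (M : Op N) : Prop :=
  ∃ B : Matrix ((u : X) → Fin (N u)) ((u : X) → Fin (N u)) ℂ, M = extendOp X B

/-- `ψ` is the unique ground state (up to a scalar) of `H`, with energy `E`, and there is a
spectral gap of at least `γ` above it. -/
structure IsGappedGroundState {d : ℕ} {Λ : Finset (Fin d → ℤ)} {N : Λ → ℕ}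
    (H : Op N) (ψ : Config N → ℂ) (E γ : ℝ) : Prop where
  normalized : star ψ ⬝ᵥ ψ = 1
  eigen : H *ᵥ ψ = (E : ℂ) • ψ
  gap : ∀ (μ : ℝ) (φ : Config N → ℂ), φ ≠ 0 → H *ᵥ φ = (μ : ℂ) • φ →
    (μ = E ∧ ∃ c : ℂ, φ = c • ψ) ∨ E + γ ≤ μ

/-! ### Gapped Hamiltonian paths and the quasi-adiabatic evolution -/

/-- A gapped path `H(s) = ∑ Q_u + ∑ V_u(s)`, `s ∈ [0,1]`, of local Hamiltonians. -/
structure GappedPath {d : ℕ} (Λ : Finset (Fin d → ℤ)) (N : Λ → ℕ)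
    (r₀ : ℕ) (J₁ J₂ γ : ℝ) where
  Q : Λ → Op N
  V : Λ → ℝ → Op N
  ψ : ℝ → Config N → ℂ
  E : ℝ → ℝ
  Q_herm : ∀ u, (Q u).IsHermitian
  Q_supp : ∀ u, SupportedOn (latBall u r₀) (Q u)
  Q_norm : ∀ u, ‖Q u‖ ≤ J₁
  V_herm : ∀ u, ∀ s ∈ Icc (0 : ℝ) 1, (V u s).IsHermitian
  V_supp : ∀ u, ∀ s ∈ Icc (0 : ℝ) 1, SupportedOn (latBall u r₀) (V u s)
  V_zero : ∀ u, V u 0 = 0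
  V_norm : ∀ u, ∀ s ∈ Icc (0 : ℝ) 1, ‖V u s‖ ≤ J₁
  V_diff : ∀ u, DifferentiableOn ℝ (V u) (Icc 0 1)
  V_deriv_norm : ∀ u, ∀ s ∈ Icc (0 : ℝ) 1, ‖derivWithin (V u) (Icc 0 1) s‖ ≤ J₂
  ground : ∀ s ∈ Icc (0 : ℝ) 1, IsGappedGroundState (∑ u, Q u + ∑ u, V u s) (ψ s) (E s) γ
  ψ_diff : DifferentiableOn ℝ ψ (Icc 0 1)

/-- `f` decays sub-exponentially: it is positive and non-increasing on `[0,∞)` with `f 0 = 1`,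
it decays faster than every stretched exponential, and it is eventually log-convex
(so that it decays at most exponentially, and regularly), as is
`r ↦ exp (-c * r / (log r)^2)`, `c > 0`, for large `r`. -/
structure SubExpDecay (f : ℝ → ℝ) : Prop where
  zero : f 0 = 1
  pos : ∀ r, 0 ≤ r → 0 < f r
  anti : AntitoneOn f (Ici 0)
  fast : ∀ α : ℝ, 0 < α → α < 1 → Tendsto (fun r : ℝ => Real.exp (r ^ α) * f r) atTop (𝓝 0)
  logConvex : ∃ r₁ : ℝ, ConvexOn ℝ (Ici r₁) fun r => Real.log (f r)

/-- A quasi-adiabatic evolution `U` along a gapped path: unitaries which transport the ground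
state and solve `∂_s U_s = i 𝒟_s U_s`, `U_0 = 𝟙`, with a quasi-local generator
`𝒟_s = ∑_u ∑_{r ≥ r₀} 𝒟_s(u;r)`, where `𝒟_s(u;r)` is supported on `b_u(r)` and
`‖𝒟_s(u;r)‖ ≤ 2 J₂ f(r - r₀)`. -/
structure QuasiAdiabaticEvolution {d : ℕ} {Λ : Finset (Fin d → ℤ)} {N : Λ → ℕ}
    {r₀ : ℕ} {J₁ J₂ γ : ℝ} (P : GappedPath Λ N r₀ J₁ J₂ γ) (f : ℝ → ℝ) where
  U : ℝ → Op N
  /-- the generator `𝒟_s` -/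
  G : ℝ → Op N
  /-- the local terms: `D u r s` is `𝒟_s(u;r)` -/
  D : Λ → ℕ → ℝ → Op N
  U_unitary : ∀ s ∈ Icc (0 : ℝ) 1, U s ∈ Matrix.unitaryGroup (Config N) ℂ
  U_zero : U 0 = 1
  U_deriv : ∀ s ∈ Icc (0 : ℝ) 1,
    HasDerivWithinAt U (Complex.I • (G s * U s)) (Icc 0 1) s
  U_ground : ∀ s ∈ Icc (0 : ℝ) 1, P.ψ s = U s *ᵥ P.ψ 0
  G_sum : ∀ s ∈ Icc (0 : ℝ) 1,
    HasSum (fun p : Λ × {r : ℕ // r₀ ≤ r} => D p.1 p.2 s) (G s)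
  D_herm : ∀ u r, r₀ ≤ r → ∀ s ∈ Icc (0 : ℝ) 1, (D u r s).IsHermitian
  D_cont : ∀ u r, r₀ ≤ r → ContinuousOn (D u r) (Icc 0 1)
  D_supp : ∀ u r, r₀ ≤ r → ∀ s ∈ Icc (0 : ℝ) 1, SupportedOn (latBall u r) (D u r s)
  D_norm : ∀ u r, r₀ ≤ r → ∀ s ∈ Icc (0 : ℝ) 1,
    ‖D u r s‖ ≤ 2 * J₂ * f ((r : ℝ) - (r₀ : ℝ))

end

/-! Group the terms of the generator by the ball on which they live, and let `UA`, `UAc` be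
generated by the terms inside `A` and inside `Aᶜ`. Their product `Z` is the evolution without the
terms crossing the boundary, and `Z⋆ U` is generated by the crossing terms in the interaction
picture of `Z`. A crossing ball contains a point of `∂A`, so by locality little changes if only the
terms inside `Y = ∂A(2R)` are kept. With `Z'`, `V` the analogues of `Z`, `U` built from those terms,
`Z'⋆ V` is supported on `Y`, is close to `Z⋆ U`, and serves as the boundary unitary
(`exists_approx_factorization`).

Locality is obtained from a weight `w` on the sites, equal to one off `Y` and small on `∂A`, for
which the terms through a site `x`, each multiplied by the total weight of its region, sum to at
most `κ w(x)` (`IsTransportWeight`). A bootstrap (`HeisenbergClose.half`, `heisenbergClose_one`)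
then bounds the difference of the evolutions of `a` under `Z` and `Z'` by `exp (4κt) w(X) ‖a‖` for
`a` supported on `X`. Integrating this over the crossing terms gives the error `(exp (4κt) - 1)
w(∂A) / 4`.

The weight is `f` of a quarter of the depth inside `Y`. It is admissible
(`exists_isTransportWeight`) because `f` is supermultiplicative up to a constant (`exists_mul_le`)
and absorbs powers when its argument is halved (`exists_mul_pow_le`); the first rests on
log-convexity, the second on log-convexity together with fast decay. -/

noncomputable section

/-! ### Linear evolution equations in Banach algebras -/

section LinearODE

variable {B : Type*} [NormedRing B] [NormedAlgebra ℝ B] [CompleteSpace B]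

/-- Picard–Lindelöf on the ball of radius `‖x₀‖` about `x₀`: there the field is bounded by `2M‖x₀‖`,
so a time `1 / (2M)` is not enough to leave the ball. -/
theorem exists_short_linear_evolution {G : ℝ → B} {M a b : ℝ} (hab : a ≤ b) (hM : 0 ≤ M)
    (hG : ContinuousOn G (Icc a b)) (hGM : ∀ t ∈ Icc a b, ‖G t‖ ≤ M)
    (hshort : 2 * M * (b - a) ≤ 1) (x₀ : B) :
    ∃ x : ℝ → B, x a = x₀ ∧
      ∀ t ∈ Icc a b, HasDerivWithinAt x (G t * x t) (Icc a b) t := by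
  lift M to NNReal using hM
  have hPL : IsPicardLindelof (fun t x => G t * x) (⟨a, left_mem_Icc.2 hab⟩ : Icc a b) x₀
      ‖x₀‖₊ 0 (M * (2 * ‖x₀‖₊)) M := by
    refine ⟨fun t ht => ?_, fun x _ => hG.mul continuousOn_const, fun t ht x hx => ?_, ?_⟩
    · refine LipschitzOnWith.of_dist_le_mul fun x _ y _ => ?_
      rw [dist_eq_norm, dist_eq_norm, ← mul_sub]
      exact (norm_mul_le _ _).trans (mul_le_mul_of_nonneg_right (hGM t ht) (norm_nonneg _))
    · have hx' : ‖x‖ ≤ 2 * ‖x₀‖ := by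
        have h1 : ‖x - x₀‖ ≤ ‖x₀‖ := by simpa [dist_eq_norm] using hx
        have h2 := norm_le_norm_add_norm_sub' x x₀
        linarith
      have h3 : ‖G t * x‖ ≤ M * (2 * ‖x₀‖) :=
        (norm_mul_le _ _).trans (mul_le_mul (hGM t ht) hx' (norm_nonneg _) M.2)
      simpa using h3
    · have h1 : (0 : ℝ) ≤ b - a := sub_nonneg.2 hab
      simp only [sub_self, max_eq_left h1, NNReal.coe_mul, NNReal.coe_ofNat,
        coe_nnnorm, NNReal.coe_zero, sub_zero]
      nlinarith [norm_nonneg x₀]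
  obtain ⟨x, h0, hx⟩ := hPL.exists_eq_forall_mem_Icc_hasDerivWithinAt₀
  exact ⟨x, h0, hx⟩

theorem hasDerivWithinAt_glue {E : Type*} [NormedAddCommGroup E] [NormedSpace ℝ E]
    {v : ℝ → E → E} {x y : ℝ → E} {a b c : ℝ} (hab : a ≤ b) (hbc : b ≤ c)
    (hx : ∀ t ∈ Icc a b, HasDerivWithinAt x (v t (x t)) (Icc a b) t)
    (hy : ∀ t ∈ Icc b c, HasDerivWithinAt y (v t (y t)) (Icc b c) t) (hxy : x b = y b) :
    ∃ z : ℝ → E, z a = x a ∧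
      ∀ t ∈ Icc a c, HasDerivWithinAt z (v t (z t)) (Icc a c) t := by
  set z : ℝ → E := fun t => if t ≤ b then x t else y t with hz
  have hzx : ∀ t ∈ Icc a b, z t = x t := fun t ht => if_pos ht.2
  have hzy : ∀ t ∈ Icc b c, z t = y t := by
    intro t ht
    rcases ht.1.eq_or_lt with h | h
    · subst h; simp [hz, hxy]
    · exact if_neg (not_le.2 h)
  refine ⟨z, hzx a (left_mem_Icc.2 hab), fun t _ => ?_⟩
  rw [← Icc_union_Icc_eq_Icc hab hbc]
  refine HasDerivWithinAt.union ?_ ?_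
  · by_cases h : t ∈ Icc a b
    · rw [hzx t h]
      exact (hx t h).congr hzx (hzx t h)
    -- Away from the closed interval the derivative within it carries no condition.
    · exact HasFDerivWithinAt.of_notMem_closure (by rwa [isClosed_Icc.closure_eq])
  · by_cases h : t ∈ Icc b c
    · rw [hzy t h]
      exact (hy t h).congr hzy (hzy t h)
    · exact HasFDerivWithinAt.of_notMem_closure (by rwa [isClosed_Icc.closure_eq])

/-- By linearity the admissible step length depends only on the bound `M` of the generator and not
on the initial value, so equal steps of length `1 / n` with `n > 2M` reach time one. -/
theorem exists_linear_evolution {G : ℝ → B} (hG : ContinuousOn G (Icc 0 1)) :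
    ∃ V : ℝ → B, V 0 = 1 ∧
      ∀ t ∈ Icc (0 : ℝ) 1, HasDerivWithinAt V (G t * V t) (Icc 0 1) t := by
  obtain ⟨M, hM⟩ := isCompact_Icc.exists_bound_of_continuousOn hG
  have hM0 : 0 ≤ M := (norm_nonneg _).trans (hM 0 (by simp))
  obtain ⟨n, hn⟩ := exists_nat_gt (2 * M)
  have hn0 : (0 : ℝ) < n := by linarith
  have key : ∀ k : ℕ, k ≤ n → ∃ V : ℝ → B, V 0 = 1 ∧
      ∀ t ∈ Icc (0 : ℝ) (k / n), HasDerivWithinAt V (G t * V t) (Icc 0 (k / n)) t := by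
    intro k
    induction k with
    | zero =>
      intro _
      have h := exists_short_linear_evolution (a := 0) (b := 0) (G := G) (M := M) le_rfl hM0
        (hG.mono (by intro t; simp; grind)) (fun t ht => hM t (by simp at ht; simp [ht]))
        (by simp) 1
      simpa using h
    | succ k ih =>
      intro hk
      obtain ⟨x, hx0, hx⟩ := ih (by omega)
      have h1 : (0 : ℝ) ≤ k / n := by positivity
      have h2 : (k : ℝ) / n ≤ (k + 1 : ℕ) / n := by gcongr; simp
      have h3 : ((k + 1 : ℕ) : ℝ) / n ≤ 1 := by
        rw [div_le_one hn0]; exact_mod_cast hk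
      have hsub : Icc ((k : ℝ) / n) ((k + 1 : ℕ) / n) ⊆ Icc 0 1 := Icc_subset_Icc h1 h3
      obtain ⟨y, hy0, hy⟩ := exists_short_linear_evolution h2 hM0 (hG.mono hsub)
        (fun t ht => hM t (hsub ht)) (by
          have : ((k + 1 : ℕ) : ℝ) / n - k / n = 1 / n := by push_cast; ring
          rw [this, mul_one_div, div_le_one hn0]; exact hn.le) (x (k / n))
      obtain ⟨z, hz0, hz⟩ := hasDerivWithinAt_glue (v := fun t x => G t * x) h1 h2 hx hy hy0.symm
      exact ⟨z, hz0.trans hx0, hz⟩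
  simpa [div_self hn0.ne'] using key n le_rfl

end LinearODE

/-! ### Unitary evolutions in C⋆-algebras -/

section Unitary

variable {𝔸 : Type*} [CStarAlgebra 𝔸]

/-- `V` solves `∂V = i K V` on `[0,1]` and consists of unitaries, with `V 0 = 1`. -/
structure IsUnitaryEvolution (K V : ℝ → 𝔸) : Prop where
  zero : V 0 = 1
  unitary : ∀ t ∈ Icc (0 : ℝ) 1, V t ∈ unitary 𝔸
  deriv : ∀ t ∈ Icc (0 : ℝ) 1, HasDerivWithinAt V (Complex.I • (K t * V t)) (Icc 0 1) t

theorem norm_unitary_mul {u : 𝔸} (hu : u ∈ unitary 𝔸) (x : 𝔸) : ‖u * x‖ = ‖x‖ :=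
  CStarRing.norm_mem_unitary_mul x hu

theorem norm_mul_unitary {u : 𝔸} (hu : u ∈ unitary 𝔸) (x : 𝔸) : ‖x * u‖ = ‖x‖ :=
  CStarRing.norm_mul_mem_unitary x hu

theorem norm_unitary_conj {u : 𝔸} (hu : u ∈ unitary 𝔸) (x : 𝔸) : ‖star u * x * u‖ = ‖x‖ := by
  rw [norm_mul_unitary hu, norm_unitary_mul (Unitary.star_mem hu)]

/-- An evolution with Hermitian generator is unitary. -/
theorem isUnitaryEvolution_of_selfAdjoint [FiniteDimensional ℂ 𝔸] {K V : ℝ → 𝔸}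
    (hK : ∀ t ∈ Icc (0 : ℝ) 1, star (K t) = K t) (h0 : V 0 = 1)
    (hV : ∀ t ∈ Icc (0 : ℝ) 1, HasDerivWithinAt V (Complex.I • (K t * V t)) (Icc 0 1) t) :
    IsUnitaryEvolution K V := by
  have hd : ∀ t ∈ Icc (0 : ℝ) 1,
      HasDerivWithinAt (fun τ => star (V τ) * V τ) 0 (Icc 0 1) t := by
    intro t ht
    have h := (hV t ht).star.mul (hV t ht)
    refine h.congr_deriv ?_
    rw [star_smul, star_mul, hK t ht]
    simp only [Complex.star_def, Complex.conj_I, neg_smul, smul_mul_assoc, mul_smul_comm, neg_mul,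
      mul_assoc, neg_add_cancel]
  have hone : ∀ t ∈ Icc (0 : ℝ) 1, star (V t) * V t = 1 := by
    intro t ht
    have h := constant_of_has_deriv_right_zero (fun t ht => (hd t ht).continuousWithinAt)
      (fun t ht => (hd t (Ico_subset_Icc_self ht)).mono_of_mem_nhdsWithin
        (Icc_mem_nhdsGE_of_mem ht)) t ht
    rw [h, h0]; simp
  refine ⟨h0, fun t ht => ?_, hV⟩
  have h1 := hone t ht
  -- In finite dimension a left inverse is also a right inverse.
  have : IsArtinianRing 𝔸 := IsArtinianRing.of_finite ℂ 𝔸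
  exact Unitary.mem_iff.2 ⟨h1, mul_eq_one_symm h1⟩

/-- The equation is solved inside `S`, itself a Banach algebra, so the evolution stays in any
subalgebra containing its generator. This provides the supports of all the unitaries. -/
theorem exists_isUnitaryEvolution [FiniteDimensional ℂ 𝔸] {K : ℝ → 𝔸}
    (hK : ∀ t ∈ Icc (0 : ℝ) 1, star (K t) = K t) (hc : ContinuousOn K (Icc 0 1))
    (S : Subalgebra ℂ 𝔸) (hS : ∀ t ∈ Icc (0 : ℝ) 1, K t ∈ S) :
    ∃ V : ℝ → 𝔸, IsUnitaryEvolution K V ∧ ∀ t, V t ∈ S := by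
  classical
  let G : ℝ → S := fun t => if h : t ∈ Icc (0 : ℝ) 1 then Complex.I • ⟨K t, hS t h⟩ else 0
  have hGK : ∀ t ∈ Icc (0 : ℝ) 1, ((G t : S) : 𝔸) = Complex.I • K t := by
    intro t ht; simp only [G, dif_pos ht]; rfl
  have hGc : ContinuousOn G (Icc 0 1) := by
    rw [Topology.IsInducing.subtypeVal.continuousOn_iff]
    exact (hc.const_smul Complex.I).congr hGK
  have : CompleteSpace S := FiniteDimensional.complete ℂ S
  obtain ⟨V, hV0, hV⟩ := exists_linear_evolution hGc
  refine ⟨fun t => V t, isUnitaryEvolution_of_selfAdjoint hK (by simp [hV0]) fun t ht => ?_,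
    fun t => (V t).2⟩
  let ι : S →L[ℝ] 𝔸 := (S.val.toLinearMap.restrictScalars ℝ).mkContinuous 1 fun x => by
    rw [one_mul]; rfl
  have h := ι.hasFDerivAt.comp_hasDerivWithinAt t (hV t ht)
  have h2 : ι (G t * V t) = Complex.I • (K t * V t) := by
    change ((G t * V t : S) : 𝔸) = _
    rw [MulMemClass.coe_mul, hGK t ht, smul_mul_assoc]
  rw [h2] at h
  exact h

end Unitary

/-! ### Comparison of unitary evolutions -/

section Comparison

variable {𝔸 : Type*} [CStarAlgebra 𝔸]

theorem norm_le_of_hasDerivWithinAt_of_norm_deriv_le {E : Type*} [NormedAddCommGroup E]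
    [NormedSpace ℝ E] {x v : ℝ → E} {β β' : ℝ → ℝ}
    (hx : ∀ t ∈ Icc (0 : ℝ) 1, HasDerivWithinAt x (v t) (Icc 0 1) t) (h0 : ‖x 0‖ ≤ β 0)
    (hβ : ∀ t, HasDerivAt β (β' t) t) (hv : ∀ t ∈ Icc (0 : ℝ) 1, ‖v t‖ ≤ β' t) :
    ∀ t ∈ Icc (0 : ℝ) 1, ‖x t‖ ≤ β t := fun _ ht =>
  image_norm_le_of_norm_deriv_right_le_deriv_boundary
    (fun t ht => (hx t ht).continuousWithinAt)
    (fun t ht => (hx t (Ico_subset_Icc_self ht)).mono_of_mem_nhdsWithin (Icc_mem_nhdsGE_of_mem ht))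
    h0 hβ (fun t ht => hv t (Ico_subset_Icc_self ht)) ht

namespace IsUnitaryEvolution

variable {K V K' V' : ℝ → 𝔸}

theorem continuousOn (h : IsUnitaryEvolution K V) : ContinuousOn V (Icc 0 1) :=
  fun t ht => (h.deriv t ht).continuousWithinAt

theorem mul_star_self (h : IsUnitaryEvolution K V) {t : ℝ} (ht : t ∈ Icc (0 : ℝ) 1) :
    V t * star (V t) = 1 := Unitary.mul_star_self_of_mem (h.unitary t ht)

theorem deriv_star (h : IsUnitaryEvolution K V) (hK : ∀ t ∈ Icc (0 : ℝ) 1, star (K t) = K t)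
    {t : ℝ} (ht : t ∈ Icc (0 : ℝ) 1) :
    HasDerivWithinAt (fun τ => star (V τ)) (-(Complex.I • (star (V t) * K t))) (Icc 0 1) t := by
  refine (h.deriv t ht).star.congr_deriv ?_
  rw [star_smul, star_mul, hK t ht]
  simp

/-- The product of two evolutions solves the evolution equation of the sum of the generators when
the first commutes with the generator of the second. -/
theorem mul (h : IsUnitaryEvolution K V) (h' : IsUnitaryEvolution K' V')
    (hc : ∀ t ∈ Icc (0 : ℝ) 1, V t * K' t = K' t * V t) :
    IsUnitaryEvolution (fun t => K t + K' t) (fun t => V t * V' t) := by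
  refine ⟨by simp [h.zero, h'.zero], fun t ht => mul_mem (h.unitary t ht) (h'.unitary t ht),
    fun t ht => ?_⟩
  refine ((h.deriv t ht).mul (h'.deriv t ht)).congr_deriv ?_
  rw [smul_mul_assoc, mul_smul_comm, ← smul_add, ← mul_assoc (V t), hc t ht]
  simp only [add_mul, mul_assoc]

/-- The evolution in the interaction picture. -/
theorem deriv_star_mul (h : IsUnitaryEvolution K V) (h' : IsUnitaryEvolution K' V')
    (hK : ∀ t ∈ Icc (0 : ℝ) 1, star (K t) = K t) {t : ℝ} (ht : t ∈ Icc (0 : ℝ) 1) :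
    HasDerivWithinAt (fun τ => star (V τ) * V' τ)
      (Complex.I • ((star (V t) * (K' t - K t) * V t) * (star (V t) * V' t))) (Icc 0 1) t := by
  refine ((h.deriv_star hK ht).mul (h'.deriv t ht)).congr_deriv ?_
  have e : star (V t) * (K' t - K t) * V t * (star (V t) * V' t)
      = star (V t) * (K' t - K t) * V' t := by
    rw [mul_assoc _ (V t), ← mul_assoc (V t) (star (V t)), h.mul_star_self ht, one_mul]
  rw [e, neg_mul, smul_mul_assoc, mul_smul_comm, neg_add_eq_sub, ← smul_sub]
  congr 1
  noncomm_ring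

theorem deriv_conj (h : IsUnitaryEvolution K V) (hK : ∀ t ∈ Icc (0 : ℝ) 1, star (K t) = K t)
    (a : 𝔸) {t : ℝ} (ht : t ∈ Icc (0 : ℝ) 1) :
    HasDerivWithinAt (fun τ => star (V τ) * a * V τ)
      (Complex.I • (star (V t) * (a * K t - K t * a) * V t)) (Icc 0 1) t := by
  refine (((h.deriv_star hK ht).mul_const a).mul (h.deriv t ht)).congr_deriv ?_
  rw [neg_mul, neg_mul, smul_mul_assoc, smul_mul_assoc, mul_smul_comm, neg_add_eq_sub, ← smul_sub]
  congr 1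
  noncomm_ring

end IsUnitaryEvolution

/-- Comparison of two evolutions in the interaction picture. -/
theorem norm_mul_star_mul_sub_le {K₀ K₀' L L' Z Z' Y U : ℝ → 𝔸} {β β' : ℝ → ℝ}
    (hZ : IsUnitaryEvolution K₀ Z) (hZ' : IsUnitaryEvolution K₀' Z')
    (hU : IsUnitaryEvolution L U) (hY : IsUnitaryEvolution L' Y)
    (hK : ∀ t ∈ Icc (0 : ℝ) 1, star (K₀ t) = K₀ t)
    (hK' : ∀ t ∈ Icc (0 : ℝ) 1, star (K₀' t) = K₀' t)
    (hL : ∀ t ∈ Icc (0 : ℝ) 1, star (L t) = L t)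
    (h0 : 0 ≤ β 0) (hβ : ∀ t, HasDerivAt β (β' t) t)
    (hq : ∀ t ∈ Icc (0 : ℝ) 1,
      ‖star (Z t) * (L t - K₀ t) * Z t - star (Z' t) * (L' t - K₀' t) * Z' t‖ ≤ β' t) :
    ∀ t ∈ Icc (0 : ℝ) 1, ‖Z t * (star (Z' t) * Y t) - U t‖ ≤ β t := by
  set k : ℝ → 𝔸 := fun t => star (Z t) * (L t - K₀ t) * Z t with hk
  set k' : ℝ → 𝔸 := fun t => star (Z' t) * (L' t - K₀' t) * Z' t with hk'
  set X : ℝ → 𝔸 := fun t => star (Z t) * U t with hX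
  set X' : ℝ → 𝔸 := fun t => star (Z' t) * Y t with hX'
  have hXu : ∀ t ∈ Icc (0 : ℝ) 1, X t ∈ unitary 𝔸 := fun t ht =>
    mul_mem (Unitary.star_mem (hZ.unitary t ht)) (hU.unitary t ht)
  have hXu' : ∀ t ∈ Icc (0 : ℝ) 1, X' t ∈ unitary 𝔸 := fun t ht =>
    mul_mem (Unitary.star_mem (hZ'.unitary t ht)) (hY.unitary t ht)
  have hks : ∀ t ∈ Icc (0 : ℝ) 1, star (k t) = k t := by
    intro t ht
    simp only [hk, star_mul, star_star, star_sub, hL t ht, hK t ht, mul_assoc]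
  -- The derivative is `k' - k` between unitaries, so the error is the plain time integral of `‖k' -
  -- k‖`, without a Gronwall factor.
  have hd : ∀ t ∈ Icc (0 : ℝ) 1, HasDerivWithinAt (fun τ => star (X τ) * X' τ - 1)
      (Complex.I • (star (X t) * (k' t - k t) * X' t)) (Icc 0 1) t := by
    intro t ht
    have d := (hZ.deriv_star_mul hU hK ht).star
    have d' := hZ'.deriv_star_mul hY hK' ht
    refine ((d.mul d').sub_const 1).congr_deriv ?_
    change star (Complex.I • (k t * X t)) * X' t + star (X t) * Complex.I • (k' t * X' t) = _
    rw [star_smul, star_mul, hks t ht]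
    simp only [Complex.star_def, Complex.conj_I, neg_smul, smul_mul_assoc, mul_smul_comm, neg_mul,
      neg_add_eq_sub, ← smul_sub]
    congr 1
    noncomm_ring
  intro t ht
  have h := norm_le_of_hasDerivWithinAt_of_norm_deriv_le hd
    (by simpa [hX, hX', hZ.zero, hZ'.zero, hU.zero, hY.zero] using h0) hβ
    (fun t ht => by
      rw [norm_smul, Complex.norm_I, one_mul, norm_mul_unitary (hXu' t ht),
        norm_unitary_mul (Unitary.star_mem (hXu t ht)), norm_sub_rev]
      exact hq t ht) t ht
  have e : U t * (star (X t) * X' t - 1) = Z t * X' t - U t := by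
    have e1 : U t * star (X t) = Z t := by
      simp only [hX, star_mul, star_star]
      rw [← mul_assoc, hU.mul_star_self ht, one_mul]
    rw [mul_sub, ← mul_assoc, e1, mul_one]
  rw [← e, norm_unitary_mul (hU.unitary t ht)]
  exact h

variable [FiniteDimensional ℂ 𝔸]

/-- A commutator with a self-adjoint element does not contribute to the growth of the norm. -/
theorem norm_le_of_deriv_eq_commutator_add {x P q : ℝ → 𝔸} {β β' : ℝ → ℝ}
    (hP : ∀ t ∈ Icc (0 : ℝ) 1, star (P t) = P t) (hPc : ContinuousOn P (Icc 0 1))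
    (hx : ∀ t ∈ Icc (0 : ℝ) 1,
      HasDerivWithinAt x (Complex.I • (x t * P t - P t * x t) + q t) (Icc 0 1) t)
    (h0 : ‖x 0‖ ≤ β 0) (hβ : ∀ t, HasDerivAt β (β' t) t)
    (hq : ∀ t ∈ Icc (0 : ℝ) 1, ‖q t‖ ≤ β' t) :
    ∀ t ∈ Icc (0 : ℝ) 1, ‖x t‖ ≤ β t := by
  have hN : ∀ t ∈ Icc (0 : ℝ) 1, star (-P t) = -P t := fun t ht => by rw [star_neg, hP t ht]
  -- Conjugation by the evolution of `-P` cancels the commutator and leaves `q` conjugated by a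
  -- unitary.
  obtain ⟨V, hV, -⟩ := exists_isUnitaryEvolution hN hPc.neg ⊤ (fun _ _ => trivial)
  have hd : ∀ t ∈ Icc (0 : ℝ) 1, HasDerivWithinAt (fun τ => star (V τ) * x τ * V τ)
      (star (V t) * q t * V t) (Icc 0 1) t := by
    intro t ht
    refine (((hV.deriv_star hN ht).mul (hx t ht)).mul (hV.deriv t ht)).congr_deriv ?_
    simp only [Pi.mul_apply, mul_neg, neg_mul, smul_neg, neg_neg, mul_add, add_mul, mul_sub,
      sub_mul, smul_sub, smul_mul_assoc, mul_smul_comm, mul_assoc]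
    abel
  intro t ht
  have h := norm_le_of_hasDerivWithinAt_of_norm_deriv_le hd (by simpa [hV.zero] using h0) hβ
    (fun t ht => by rw [norm_unitary_conj (hV.unitary t ht)]; exact hq t ht) t ht
  rwa [norm_unitary_conj (hV.unitary t ht)] at h

/-- Only the parts of the generators which do not commute with `a` matter for the difference of
two Heisenberg evolutions of `a`. -/
theorem norm_conj_sub_conj_le {K₁ K₂ K₁' K₂' Z Z' : ℝ → 𝔸} {a : 𝔸} {β β' : ℝ → ℝ}
    (hZ : IsUnitaryEvolution (fun t => K₁ t + K₂ t) Z)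
    (hZ' : IsUnitaryEvolution (fun t => K₁' t + K₂' t) Z')
    (hK₁ : ∀ t ∈ Icc (0 : ℝ) 1, star (K₁ t) = K₁ t)
    (hK₂ : ∀ t ∈ Icc (0 : ℝ) 1, star (K₂ t) = K₂ t)
    (hK₁' : ∀ t ∈ Icc (0 : ℝ) 1, star (K₁' t) = K₁' t)
    (hK₂' : ∀ t ∈ Icc (0 : ℝ) 1, star (K₂' t) = K₂' t)
    (hc : ContinuousOn K₁ (Icc 0 1))
    (ha : ∀ t ∈ Icc (0 : ℝ) 1, a * K₂ t = K₂ t * a)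
    (ha' : ∀ t ∈ Icc (0 : ℝ) 1, a * K₂' t = K₂' t * a)
    (h0 : 0 ≤ β 0) (hβ : ∀ t, HasDerivAt β (β' t) t)
    (hq : ∀ t ∈ Icc (0 : ℝ) 1,
      2 * ‖a‖ * ‖star (Z t) * K₁ t * Z t - star (Z' t) * K₁' t * Z' t‖ ≤ β' t) :
    ∀ t ∈ Icc (0 : ℝ) 1, ‖star (Z t) * a * Z t - star (Z' t) * a * Z' t‖ ≤ β t := by
  have hcomm : ∀ {L₁ L₂ Y : ℝ → 𝔸} {t : ℝ}, IsUnitaryEvolution (fun t => L₁ t + L₂ t) Y →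
      t ∈ Icc (0 : ℝ) 1 → a * L₂ t = L₂ t * a →
      star (Y t) * (a * (L₁ t + L₂ t) - (L₁ t + L₂ t) * a) * Y t =
        (star (Y t) * a * Y t) * (star (Y t) * L₁ t * Y t)
          - (star (Y t) * L₁ t * Y t) * (star (Y t) * a * Y t) := by
    intro L₁ L₂ Y t hY ht hL
    have e : ∀ b c : 𝔸, (star (Y t) * b * Y t) * (star (Y t) * c * Y t)
        = star (Y t) * (b * c) * Y t := by
      intro b c
      calc (star (Y t) * b * Y t) * (star (Y t) * c * Y t)
          = star (Y t) * b * (Y t * star (Y t)) * c * Y t := by simp only [mul_assoc]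
        _ = _ := by rw [hY.mul_star_self ht, mul_one]; simp only [mul_assoc]
    rw [e, e, ← sub_mul, ← mul_sub]
    congr 2
    rw [mul_add, add_mul, hL]
    abel
  -- With `α`, `α'` the evolved `a` and `k`, `k'` the evolved `K₁`, `K₁'`, one has `[α, k] - [α',
  -- k'] = [α - α', k] + [α', k - k']`. The first commutator preserves the norm of `α - α'`; the
  -- second is the source term.
  refine norm_le_of_deriv_eq_commutator_add (P := fun t => star (Z t) * K₁ t * Z t)
    (q := fun t => Complex.I •
      ((star (Z' t) * a * Z' t) * (star (Z t) * K₁ t * Z t - star (Z' t) * K₁' t * Z' t)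
        - (star (Z t) * K₁ t * Z t - star (Z' t) * K₁' t * Z' t) * (star (Z' t) * a * Z' t)))
    ?_ ((hZ.continuousOn.star.mul hc).mul hZ.continuousOn) ?_ ?_ hβ ?_
  · intro t ht
    simp only [star_mul, star_star, hK₁ t ht, mul_assoc]
  · intro t ht
    have d := hZ.deriv_conj (fun t ht => by rw [star_add, hK₁ t ht, hK₂ t ht]) a ht
    have d' := hZ'.deriv_conj (fun t ht => by rw [star_add, hK₁' t ht, hK₂' t ht]) a ht
    refine (d.sub d').congr_deriv ?_
    rw [hcomm hZ ht (ha t ht), hcomm hZ' ht (ha' t ht), ← smul_sub, ← smul_add]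
    congr 1
    noncomm_ring
  · simpa [hZ.zero, hZ'.zero] using h0
  · intro t ht
    refine le_trans ?_ (hq t ht)
    rw [norm_smul, Complex.norm_I, one_mul]
    refine (norm_sub_le _ _).trans ?_
    have e : ‖star (Z' t) * a * Z' t‖ = ‖a‖ := norm_unitary_conj (hZ'.unitary t ht) a
    have h1 := norm_mul_le (star (Z' t) * a * Z' t)
      (star (Z t) * K₁ t * Z t - star (Z' t) * K₁' t * Z' t)
    have h2 := norm_mul_le (star (Z t) * K₁ t * Z t - star (Z' t) * K₁' t * Z' t)
      (star (Z' t) * a * Z' t)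
    rw [e] at h1 h2
    linarith

end Comparison

/-! ### Locality of evolutions generated by interactions -/

section Locality

open scoped Classical

variable {ι : Type*} {𝔸 : Type*} [CStarAlgebra 𝔸]

/-- A family of local algebras: monotone, and commuting for disjoint regions. -/
structure IsLocalNet (𝓛 : Set ι → StarSubalgebra ℂ 𝔸) : Prop where
  mono : ∀ {X Y : Set ι}, X ⊆ Y → 𝓛 X ≤ 𝓛 Y
  commute : ∀ {X Y : Set ι}, Disjoint X Y → ∀ a ∈ 𝓛 X, ∀ c ∈ 𝓛 Y, a * c = c * a

/-- A time-dependent interaction with terms of norm at most `b X`. -/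
structure IsInteraction (𝓛 : Set ι → StarSubalgebra ℂ 𝔸) (Φ : Set ι → ℝ → 𝔸) (b : Set ι → ℝ) :
    Prop where
  herm : ∀ X, ∀ t ∈ Icc (0 : ℝ) 1, star (Φ X t) = Φ X t
  cont : ∀ X, ContinuousOn (Φ X) (Icc 0 1)
  mem : ∀ X, ∀ t ∈ Icc (0 : ℝ) 1, Φ X t ∈ 𝓛 X
  norm_le : ∀ X, ∀ t ∈ Icc (0 : ℝ) 1, ‖Φ X t‖ ≤ b X

/-- The generator made of the terms in `S`. -/
def partialGen (Φ : Set ι → ℝ → 𝔸) (S : Finset (Set ι)) (t : ℝ) : 𝔸 := ∑ X ∈ S, Φ X t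

namespace IsInteraction

variable {𝓛 : Set ι → StarSubalgebra ℂ 𝔸} {Φ : Set ι → ℝ → 𝔸} {b : Set ι → ℝ}

theorem bound_nonneg (h : IsInteraction 𝓛 Φ b) (X : Set ι) : 0 ≤ b X :=
  (norm_nonneg _).trans (h.norm_le X 0 (by simp))

theorem herm_partialGen (h : IsInteraction 𝓛 Φ b) (S : Finset (Set ι)) :
    ∀ t ∈ Icc (0 : ℝ) 1, star (partialGen Φ S t) = partialGen Φ S t := by
  intro t ht
  rw [partialGen, star_sum]
  exact Finset.sum_congr rfl fun X _ => h.herm X t ht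

theorem continuousOn_partialGen (h : IsInteraction 𝓛 Φ b) (S : Finset (Set ι)) :
    ContinuousOn (partialGen Φ S) (Icc 0 1) :=
  continuousOn_finsetSum _ fun X _ => h.cont X

theorem partialGen_mem (h : IsInteraction 𝓛 Φ b) (hN : IsLocalNet 𝓛) {S : Finset (Set ι)}
    {Y : Set ι} (hS : ∀ X ∈ S, X ⊆ Y) : ∀ t ∈ Icc (0 : ℝ) 1, partialGen Φ S t ∈ 𝓛 Y :=
  fun t ht => sum_mem fun X hX => hN.mono (hS X hX) (h.mem X t ht)

theorem exists_evolution [FiniteDimensional ℂ 𝔸] (h : IsInteraction 𝓛 Φ b) (hN : IsLocalNet 𝓛)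
    {S : Finset (Set ι)} {Y : Set ι} (hS : ∀ X ∈ S, X ⊆ Y) :
    ∃ V : ℝ → 𝔸, IsUnitaryEvolution (partialGen Φ S) V ∧ ∀ t, V t ∈ 𝓛 Y :=
  exists_isUnitaryEvolution (h.herm_partialGen S) (h.continuousOn_partialGen S)
    (𝓛 Y).toSubalgebra (h.partialGen_mem hN hS)

/-- Restricting an interaction to the terms in `S`. -/
theorem restrict (h : IsInteraction 𝓛 Φ b) (S : Finset (Set ι)) :
    IsInteraction 𝓛 (fun X t => if X ∈ S then Φ X t else 0) b := by
  refine ⟨fun X t ht => ?_, fun X => ?_, fun X t ht => ?_, fun X t ht => ?_⟩ <;>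
    by_cases hX : X ∈ S <;> simp only [hX, if_true, if_false]
  · exact h.herm X t ht
  · exact star_zero _
  · exact h.cont X
  · exact continuousOn_const
  · exact h.mem X t ht
  · exact zero_mem _
  · exact h.norm_le X t ht
  · simpa using h.bound_nonneg X

end IsInteraction

theorem partialGen_restrict (Φ : Set ι → ℝ → 𝔸) {S S' : Finset (Set ι)} (hS : S' ⊆ S) (t : ℝ) :
    partialGen (fun X t => if X ∈ S' then Φ X t else 0) S t = partialGen Φ S' t := by
  rw [partialGen, partialGen, ← Finset.sum_filter, Finset.filter_mem_eq_inter,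
    Finset.inter_eq_right.2 hS]

variable [Fintype ι]

/-- The total weight of a set of sites. -/
def setWeight (w : ι → ℝ) (X : Set ι) : ℝ := ∑ z, X.indicator w z

theorem setWeight_nonneg {w : ι → ℝ} (hw : ∀ x, 0 < w x) (X : Set ι) : 0 ≤ setWeight w X :=
  Finset.sum_nonneg fun _ _ => indicator_nonneg (fun x _ => (hw x).le) _

theorem le_setWeight {w : ι → ℝ} (hw : ∀ x, 0 < w x) {X : Set ι} {x : ι} (hx : x ∈ X) :
    w x ≤ setWeight w X := by
  have h := Finset.single_le_sum (f := X.indicator w)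
    (fun z _ => indicator_nonneg (fun x _ => (hw x).le) z) (Finset.mem_univ x)
  rwa [indicator_of_mem hx] at h

/-- The interaction `b` decays so fast that the weight `w` is an approximate supersolution of the
associated transport problem. -/
def IsTransportWeight (b : Set ι → ℝ) (w : ι → ℝ) (κ : ℝ) : Prop :=
  ∀ x, ∑ X : Set ι with x ∈ X, b X * setWeight w X ≤ κ * w x

/-- Each `p` meets `X` in some site, so the sum is dominated by summing, over the sites of `X`, all
terms through that site; the transport inequality applies to each site. -/
theorem sum_mul_setWeight_le {b : Set ι → ℝ} {w : ι → ℝ} {κ : ℝ} (hb : ∀ X, 0 ≤ b X)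
    (hw : ∀ x, 0 < w x) (hT : IsTransportWeight b w κ) (T : Finset (Set ι)) (X : Set ι)
    (hTX : ∀ p ∈ T, (p ∩ X).Nonempty) :
    ∑ p ∈ T, b p * setWeight w p ≤ κ * setWeight w X := by
  have h0 : ∀ p, 0 ≤ b p * setWeight w p := fun p => mul_nonneg (hb p) (setWeight_nonneg hw p)
  calc ∑ p ∈ T, b p * setWeight w p
      ≤ ∑ p ∈ T, ∑ x with x ∈ X, if x ∈ p then b p * setWeight w p else 0 := by
        refine Finset.sum_le_sum fun p hp => ?_
        obtain ⟨x, hxp, hxX⟩ := hTX p hp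
        refine le_trans ?_ (Finset.single_le_sum (fun y _ => ?_)
          (Finset.mem_filter.2 ⟨Finset.mem_univ x, hxX⟩))
        · simp [hxp]
        · split_ifs
          exacts [h0 p, le_rfl]
    _ = ∑ x with x ∈ X, ∑ p ∈ T, if x ∈ p then b p * setWeight w p else 0 := Finset.sum_comm
    _ ≤ ∑ x with x ∈ X, κ * w x := by
        refine Finset.sum_le_sum fun x _ => le_trans ?_ (hT x)
        rw [← Finset.sum_filter]
        exact Finset.sum_le_sum_of_subset_of_nonneg
          (Finset.filter_subset_filter _ (Finset.subset_univ T)) fun p _ _ => h0 p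
    _ = κ * setWeight w X := by
        rw [← Finset.mul_sum, setWeight, Finset.sum_filter]
        rfl

variable {𝓛 : Set ι → StarSubalgebra ℂ 𝔸} {Φ : Set ι → ℝ → 𝔸}
  {b : Set ι → ℝ} {w : ι → ℝ} {κ : ℝ} {S S' : Finset (Set ι)} {Z Z' : ℝ → 𝔸}

/-- The estimate `‖Z⋆ a Z - Z'⋆ a Z'‖ ≤ m exp (4 κ t) w(X) ‖a‖` for all `a` supported on `X`. -/
def HeisenbergClose (𝓛 : Set ι → StarSubalgebra ℂ 𝔸) (w : ι → ℝ) (κ : ℝ) (Z Z' : ℝ → 𝔸)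
    (m : ℝ) : Prop :=
  ∀ X : Set ι, X.Nonempty → ∀ a ∈ 𝓛 X, ∀ t ∈ Icc (0 : ℝ) 1,
    ‖star (Z t) * a * Z t - star (Z' t) * a * Z' t‖
      ≤ m * Real.exp (4 * κ * t) * setWeight w X * ‖a‖

/-- The estimate `HeisenbergClose` bounds the difference of the evolved terms of an interaction
and of its restriction to a set of terms. -/
theorem HeisenbergClose.sum_le {m : ℝ} (hC : HeisenbergClose 𝓛 w κ Z Z' m) (hm : 1 ≤ m)
    (h : IsInteraction 𝓛 Φ b) (hw : ∀ x, 0 < w x) (hκ : 0 ≤ κ) (hT : IsTransportWeight b w κ)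
    (hZ : ∀ t ∈ Icc (0 : ℝ) 1, Z t ∈ unitary 𝔸)
    (T : Finset (Set ι)) (hTS : ∀ p ∈ T, p ∉ S' → 1 ≤ setWeight w p) (X : Set ι)
    (hTX : ∀ p ∈ T, (p ∩ X).Nonempty) {t : ℝ} (ht : t ∈ Icc (0 : ℝ) 1) :
    ‖star (Z t) * partialGen Φ T t * Z t
        - star (Z' t) * partialGen (fun X t => if X ∈ S' then Φ X t else 0) T t * Z' t‖
      ≤ m * Real.exp (4 * κ * t) * (κ * setWeight w X) := by
  have he : 1 ≤ Real.exp (4 * κ * t) := Real.one_le_exp (by have := ht.1; positivity)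
  have hme : 1 ≤ m * Real.exp (4 * κ * t) := one_le_mul_of_one_le_of_one_le hm he
  refine le_trans ?_ (mul_le_mul_of_nonneg_left
    (sum_mul_setWeight_le h.bound_nonneg hw hT T X hTX) (zero_le_one.trans hme))
  simp only [partialGen, Finset.mul_sum, Finset.sum_mul]
  rw [← Finset.sum_sub_distrib]
  refine norm_sum_le_of_le _ fun p hp => ?_
  have hb := h.bound_nonneg p
  by_cases hpS : p ∈ S'
  · simp only [hpS, if_true]
    refine (hC p ((hTX p hp).mono inter_subset_left) _ (h.mem p t ht) t ht).trans ?_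
    rw [mul_assoc, mul_comm (setWeight w p)]
    have := setWeight_nonneg hw p
    have := h.norm_le p t ht
    gcongr
  -- A discarded term has no counterpart under `Z'`, but its region has weight at least one, so `b
  -- p` is already below the claimed bound. Here `1 ≤ m` is needed.
  · simp only [hpS, if_false, mul_zero, zero_mul, sub_zero]
    rw [norm_unitary_conj (hZ t ht)]
    have h1 := hTS p hp hpS
    calc ‖Φ p t‖ ≤ b p := h.norm_le p t ht
      _ ≤ b p * setWeight w p := le_mul_of_one_le_right hb h1
      _ ≤ m * Real.exp (4 * κ * t) * (b p * setWeight w p) :=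
          le_mul_of_one_le_left (by positivity) hme

variable [FiniteDimensional ℂ 𝔸]

/-- The bound improves itself. Only terms meeting `X` drive the difference and the commutator costs
a factor 2, so it grows at rate at most `2κm exp (4κt) w(X) ‖a‖`; integration divides by `4κ` and
leaves `m / 2`. -/
theorem HeisenbergClose.half {m : ℝ} (hC : HeisenbergClose 𝓛 w κ Z Z' m) (hm : 1 ≤ m)
    (hN : IsLocalNet 𝓛) (h : IsInteraction 𝓛 Φ b) (hw : ∀ x, 0 < w x) (hκ : 0 ≤ κ)
    (hT : IsTransportWeight b w κ) (hS : S' ⊆ S) (hSS : ∀ p ∈ S, p ∉ S' → 1 ≤ setWeight w p)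
    (hZ : IsUnitaryEvolution (partialGen Φ S) Z) (hZ' : IsUnitaryEvolution (partialGen Φ S') Z') :
    HeisenbergClose 𝓛 w κ Z Z' (m / 2) := by
  intro X hX a ha
  set Φ' : Set ι → ℝ → 𝔸 := fun X t => if X ∈ S' then Φ X t else 0 with hΦ'
  have h' : IsInteraction 𝓛 Φ' b := h.restrict S'
  set T : Finset (Set ι) := S.filter fun p => (p ∩ X).Nonempty with hTdef
  set T' : Finset (Set ι) := S.filter fun p => ¬(p ∩ X).Nonempty with hTdef'
  have hsplit : ∀ Ψ : Set ι → ℝ → 𝔸,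
      partialGen Ψ S = fun t => partialGen Ψ T t + partialGen Ψ T' t := fun Ψ =>
    funext fun t => (Finset.sum_filter_add_sum_filter_not S _ _).symm
  have hcomm : ∀ {Ψ : Set ι → ℝ → 𝔸}, IsInteraction 𝓛 Ψ b →
      ∀ t ∈ Icc (0 : ℝ) 1, a * partialGen Ψ T' t = partialGen Ψ T' t * a := by
    intro Ψ hΨ t ht
    rw [partialGen, Finset.mul_sum, Finset.sum_mul]
    refine Finset.sum_congr rfl fun p hp => hN.commute (X := X) (Y := p) ?_ a ha _ (hΨ.mem p t ht)
    rw [disjoint_comm, disjoint_iff_inter_eq_empty, ← not_nonempty_iff_eq_empty]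
    exact (Finset.mem_filter.1 hp).2
  have hZ₂ := hZ
  rw [hsplit Φ] at hZ₂
  have hZ₂' := hZ'
  rw [← show partialGen Φ' S = partialGen Φ S' from funext (partialGen_restrict Φ hS),
    hsplit Φ'] at hZ₂'
  refine norm_conj_sub_conj_le hZ₂ hZ₂' (h.herm_partialGen T) (h.herm_partialGen T')
    (h'.herm_partialGen T) (h'.herm_partialGen T') (h.continuousOn_partialGen T)
    (hcomm h) (hcomm h')
    (β := fun t => m / 2 * Real.exp (4 * κ * t) * setWeight w X * ‖a‖)
    (β' := fun t => m / 2 * (Real.exp (4 * κ * t) * (4 * κ)) * setWeight w X * ‖a‖) ?_ ?_ ?_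
  · have := setWeight_nonneg hw X
    positivity
  · intro t
    have := ((hasDerivAt_id t).const_mul (4 * κ)).exp
    simp only [id, mul_one] at this
    exact ((this.const_mul (m / 2)).mul_const _).mul_const _
  · intro t ht
    have := hC.sum_le (S' := S') hm h hw hκ hT hZ.unitary T
      (fun p hp => hSS p (Finset.mem_filter.1 hp).1) X (fun p hp => (Finset.mem_filter.1 hp).2) ht
    calc 2 * ‖a‖ * _ ≤ 2 * ‖a‖ * (m * Real.exp (4 * κ * t) * (κ * setWeight w X)) := by gcongr
      _ = _ := by ring

/-- **Locality**: evolutions whose generators differ by terms which reach the region of weight at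
least one are close on observables supported where the weight is small. -/
theorem heisenbergClose_one (hN : IsLocalNet 𝓛) (h : IsInteraction 𝓛 Φ b) (hw : ∀ x, 0 < w x)
    (hκ : 0 ≤ κ) (hT : IsTransportWeight b w κ) (hS : S' ⊆ S)
    (hSS : ∀ p ∈ S, p ∉ S' → 1 ≤ setWeight w p)
    (hZ : IsUnitaryEvolution (partialGen Φ S) Z) (hZ' : IsUnitaryEvolution (partialGen Φ S') Z') :
    HeisenbergClose 𝓛 w κ Z Z' 1 := by
  have hdown : ∀ n : ℕ, HeisenbergClose 𝓛 w κ Z Z' (2 ^ n) → HeisenbergClose 𝓛 w κ Z Z' 1 := by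
    intro n
    induction n with
    | zero => simp
    | succ n ih =>
      intro hC
      refine ih ?_
      have := hC.half (one_le_pow₀ one_le_two) hN h hw hκ hT hS hSS hZ hZ'
      rwa [pow_succ, mul_div_cancel_right₀ _ two_ne_zero] at this
  -- For large `m` the estimate is trivial: the left side is at most `2‖a‖` and the finitely many
  -- weights are positive. The size of `n` does not matter, as repeated halving removes it.
  obtain ⟨n, hn⟩ : ∃ n : ℕ, ∀ x, 2 ≤ 2 ^ n * w x := by
    have h1 : ∀ᶠ n : ℕ in atTop, ∀ x, 2 ≤ 2 ^ n * w x := by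
      rw [eventually_all]
      intro x
      exact ((tendsto_pow_atTop_atTop_of_one_lt one_lt_two).atTop_mul_const
        (hw x)).eventually_ge_atTop 2
    exact h1.exists
  refine hdown n fun X hX a _ t ht => ?_
  obtain ⟨x, hx⟩ := hX
  have he : 1 ≤ Real.exp (4 * κ * t) := Real.one_le_exp (by have := ht.1; positivity)
  have h2 : 2 ≤ 2 ^ n * Real.exp (4 * κ * t) * setWeight w X := by
    have h3 := le_setWeight hw hx
    have h4 := setWeight_nonneg hw X
    calc (2 : ℝ) ≤ 2 ^ n * w x := hn x
      _ ≤ 2 ^ n * setWeight w X := by gcongr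
      _ ≤ 2 ^ n * Real.exp (4 * κ * t) * setWeight w X := by
          gcongr; exact le_mul_of_one_le_right (by positivity) he
  calc _ ≤ ‖star (Z t) * a * Z t‖ + ‖star (Z' t) * a * Z' t‖ := norm_sub_le _ _
    _ = 2 * ‖a‖ := by
        rw [norm_unitary_conj (hZ.unitary t ht), norm_unitary_conj (hZ'.unitary t ht), two_mul]
    _ ≤ _ := by gcongr

/-- An evolution factorizes approximately into evolutions on `A`, on `Aᶜ`, and on a region `Y`
containing all points of weight less than one. -/
theorem exists_approx_factorization (hN : IsLocalNet 𝓛) (h : IsInteraction 𝓛 Φ b) {U : ℝ → 𝔸}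
    (hU : IsUnitaryEvolution (partialGen Φ Finset.univ) U) (A bd : Set ι)
    (hbd : ∀ X, b X ≠ 0 → ¬X ⊆ A → ¬X ⊆ Aᶜ → (X ∩ bd).Nonempty) :
    ∃ UA UAc : ℝ → 𝔸, (∀ t ∈ Icc (0 : ℝ) 1, UA t ∈ unitary 𝔸) ∧ (∀ t, UA t ∈ 𝓛 A) ∧
      (∀ t ∈ Icc (0 : ℝ) 1, UAc t ∈ unitary 𝔸) ∧ (∀ t, UAc t ∈ 𝓛 Aᶜ) ∧
      ∀ (Y : Set ι) (w : ι → ℝ) (κ : ℝ), 0 ≤ κ → (∀ x, 0 < w x) → (∀ x ∉ Y, 1 ≤ w x) →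
        IsTransportWeight b w κ →
      ∃ UB : ℝ → 𝔸, (∀ t ∈ Icc (0 : ℝ) 1, UB t ∈ unitary 𝔸) ∧ (∀ t, UB t ∈ 𝓛 Y) ∧
        ∀ t ∈ Icc (0 : ℝ) 1, ‖UA t * UAc t * UB t - U t‖
          ≤ 1 / 4 * (Real.exp (4 * κ * t) - 1) * setWeight w bd := by
  set SA : Finset (Set ι) := Finset.univ.filter fun X => X ⊆ A with hSA
  -- Excluding `X ⊆ A` prevents the empty region from being counted twice.
  set SAc : Finset (Set ι) := Finset.univ.filter fun X => ¬X ⊆ A ∧ X ⊆ Aᶜ with hSAc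
  set S₀ : Finset (Set ι) := Finset.univ.filter fun X => X ⊆ A ∨ X ⊆ Aᶜ with hS₀
  set Sc : Finset (Set ι) := Finset.univ.filter fun X => ¬(X ⊆ A ∨ X ⊆ Aᶜ) with hSc
  obtain ⟨UA, hUA, hUAm⟩ := h.exists_evolution hN (S := SA) (Y := A)
    (fun X hX => (Finset.mem_filter.1 hX).2)
  obtain ⟨UAc, hUAc, hUAcm⟩ := h.exists_evolution hN (S := SAc) (Y := Aᶜ)
    (fun X hX => (Finset.mem_filter.1 hX).2.2)
  refine ⟨UA, UAc, hUA.unitary, hUAm, hUAc.unitary, hUAcm, ?_⟩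
  intro Y w κ hκ hw hwY hT
  set S₀' : Finset (Set ι) := S₀.filter fun X => X ⊆ Y with hS₀'
  set SY : Finset (Set ι) := Finset.univ.filter fun X => X ⊆ Y with hSY
  obtain ⟨Z', hZ', hZm'⟩ := h.exists_evolution hN (S := S₀') (Y := Y)
    (fun X hX => (Finset.mem_filter.1 hX).2)
  obtain ⟨V, hV, hVm⟩ := h.exists_evolution hN (S := SY) (Y := Y)
    (fun X hX => (Finset.mem_filter.1 hX).2)
  have hZ : IsUnitaryEvolution (partialGen Φ S₀) (fun t => UA t * UAc t) := by
    have hsum : partialGen Φ S₀ = fun t => partialGen Φ SA t + partialGen Φ SAc t := by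
      funext t
      rw [partialGen, partialGen, partialGen, ← Finset.sum_union]
      · congr 1
        ext X
        simp only [hSA, hSAc, hS₀, Finset.mem_union, Finset.mem_filter, Finset.mem_univ, true_and]
        tauto
      · rw [Finset.disjoint_left]
        intro X h1 h2
        exact (Finset.mem_filter.1 h2).2.1 (Finset.mem_filter.1 h1).2
    rw [hsum]
    refine hUA.mul hUAc fun t ht => hN.commute (disjoint_compl_right (a := A)) _ (hUAm t) _ ?_
    exact h.partialGen_mem hN (fun X hX => (Finset.mem_filter.1 hX).2.2) t ht
  have hnotY : ∀ p : Set ι, ¬p ⊆ Y → 1 ≤ setWeight w p := by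
    intro p hp
    obtain ⟨x, hxp, hxY⟩ := not_subset.1 hp
    exact (hwY x hxY).trans (le_setWeight hw hxp)
  have hC := heisenbergClose_one hN h hw hκ hT (Finset.filter_subset _ _)
    (fun p hp hp' => hnotY p fun hY => hp' (Finset.mem_filter.2 ⟨hp, hY⟩)) hZ hZ'
  -- Dividing the evolution inside `Y` by its uncoupled part leaves the crossing terms inside `Y`,
  -- in the interaction picture of `Z'`.
  refine ⟨fun t => star (Z' t) * V t, fun t ht => mul_mem (Unitary.star_mem (hZ'.unitary t ht))
    (hV.unitary t ht), fun t => mul_mem (star_mem (hZm' t)) (hVm t), ?_⟩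
  set T : Finset (Set ι) := Sc.filter fun X => (X ∩ bd).Nonempty with hTdef
  have hdiff : ∀ {Ψ : Set ι → ℝ → 𝔸}, IsInteraction 𝓛 Ψ b → ∀ t ∈ Icc (0 : ℝ) 1,
      partialGen Ψ Finset.univ t - partialGen Ψ S₀ t = partialGen Ψ T t := by
    intro Ψ hΨ t ht
    have h1 : partialGen Ψ Finset.univ t = partialGen Ψ S₀ t + partialGen Ψ Sc t :=
      (Finset.sum_filter_add_sum_filter_not _ _ _).symm
    rw [h1, add_sub_cancel_left]
    refine (Finset.sum_filter_of_ne fun X hX hne => ?_).symm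
    obtain ⟨h2, h3⟩ := not_or.1 (Finset.mem_filter.1 hX).2
    refine hbd X (fun hb => hne ?_) h2 h3
    have := hΨ.norm_le X t ht
    rw [hb] at this
    exact norm_le_zero_iff.1 this
  have hdiff' : ∀ t ∈ Icc (0 : ℝ) 1, partialGen Φ SY t - partialGen Φ S₀' t
      = partialGen (fun X t => if X ∈ SY then Φ X t else 0) T t := by
    intro t ht
    have e : partialGen Φ S₀' t
        = partialGen (fun X t => if X ∈ SY then Φ X t else 0) S₀ t := by
      rw [partialGen, partialGen, hS₀', Finset.sum_filter]
      simp [hSY]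
    rw [← hdiff (h.restrict SY) t ht, e, partialGen_restrict Φ (Finset.subset_univ SY) t]
  -- The two interaction-picture generators differ by at most `κ exp (4κt) w(bd)`; its time integral
  -- produces the factor `1 / 4`.
  refine norm_mul_star_mul_sub_le hZ hZ' hU hV (h.herm_partialGen _) (h.herm_partialGen _)
    (h.herm_partialGen _) (β := fun t => 1 / 4 * (Real.exp (4 * κ * t) - 1) * setWeight w bd)
    (β' := fun t => 1 / 4 * (Real.exp (4 * κ * t) * (4 * κ)) * setWeight w bd) (by simp) ?_ ?_
  · intro t
    have := ((hasDerivAt_id t).const_mul (4 * κ)).exp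
    simp only [id, mul_one] at this
    exact ((this.sub_const 1).const_mul _).mul_const _
  · intro t ht
    rw [hdiff h t ht, hdiff' t ht]
    refine (hC.sum_le (S' := SY) le_rfl h hw hκ hT hZ.unitary T (fun p _ hp' => hnotY p fun hY =>
      hp' (Finset.mem_filter.2 ⟨Finset.mem_univ _, hY⟩)) bd
      (fun p hp => (Finset.mem_filter.1 hp).2) ht).trans (le_of_eq ?_)
    ring

end Locality

/-! ### Sub-exponentially decaying functions -/

/-- The inner points are convex combinations of the endpoints with interchanged coefficients; the
two convexity inequalities are added. -/
theorem ConvexOn.add_le_add_endpoints {g : ℝ → ℝ} {a p q : ℝ} (hg : ConvexOn ℝ (Ici a) g)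
    (hp : 0 ≤ p) (hq : 0 ≤ q) : g (a + p) + g (a + q) ≤ g a + g (a + p + q) := by
  rcases (add_nonneg hp hq).eq_or_lt with h | h
  · have hp0 : p = 0 := by linarith
    have hq0 : q = 0 := by linarith
    simp [hp0, hq0]
  have hm : a + p + q ∈ Ici a := by rw [mem_Ici]; linarith
  have hsum : q / (p + q) + p / (p + q) = 1 := by field_simp; ring
  have h1 := hg.2 (mem_Ici.2 le_rfl) hm (div_nonneg hq h.le) (div_nonneg hp h.le) hsum
  have h2 := hg.2 (mem_Ici.2 le_rfl) hm (div_nonneg hp h.le) (div_nonneg hq h.le)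
    ((add_comm _ _).trans hsum)
  have e1 : (q / (p + q)) • a + (p / (p + q)) • (a + p + q) = a + p := by
    simp only [smul_eq_mul]; field_simp; ring
  have e2 : (p / (p + q)) • a + (q / (p + q)) • (a + p + q) = a + q := by
    simp only [smul_eq_mul]; field_simp; ring
  rw [e1] at h1
  rw [e2] at h2
  simp only [smul_eq_mul] at h1 h2
  calc g (a + p) + g (a + q) ≤ (q / (p + q) + p / (p + q)) * (g a + g (a + p + q)) := by linarith
    _ = _ := by rw [hsum, one_mul]

namespace SubExpDecay

variable {f : ℝ → ℝ}

theorem le_one (hf : SubExpDecay f) {r : ℝ} (hr : 0 ≤ r) : f r ≤ 1 :=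
  hf.zero ▸ hf.anti (mem_Ici.2 le_rfl) hr hr

theorem log_nonpos (hf : SubExpDecay f) {r : ℝ} (hr : 0 ≤ r) : Real.log (f r) ≤ 0 :=
  Real.log_nonpos (hf.pos r hr).le (hf.le_one hr)

theorem log_anti (hf : SubExpDecay f) {a b : ℝ} (ha : 0 ≤ a) (hab : a ≤ b) :
    Real.log (f b) ≤ Real.log (f a) :=
  Real.log_le_log (hf.pos b (ha.trans hab)) (hf.anti ha (ha.trans hab) hab)

theorem exists_nonneg_logConvex (hf : SubExpDecay f) :
    ∃ a : ℝ, 0 ≤ a ∧ ConvexOn ℝ (Ici a) fun r => Real.log (f r) := by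
  obtain ⟨r₁, h⟩ := hf.logConvex
  exact ⟨max r₁ 0, le_max_right _ _,
    h.subset (Ici_subset_Ici.2 (le_max_left _ _)) (convex_Ici _)⟩

/-- Log-convexity makes `f` supermultiplicative up to a constant. -/
theorem exists_mul_le (hf : SubExpDecay f) :
    ∃ C : ℝ, 0 < C ∧ ∀ a b : ℝ, 0 ≤ a → 0 ≤ b → f a * f b ≤ C * f (a + b) := by
  obtain ⟨r, hr, hg⟩ := hf.exists_nonneg_logConvex
  -- Convexity holds only from `r` on. Shifting by `r` brings the argument into that range at the
  -- cost of the constant `f (2 * r)`; small arguments are handled by monotonicity.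
  have hshift : ∀ b, 0 ≤ b →
      Real.log (f b) + Real.log (f (2 * r)) ≤ Real.log (f (r + b)) := by
    intro b hb
    rcases le_or_gt r b with h | h
    · have := hg.add_le_add_endpoints (sub_nonneg.2 h) hr
      rw [add_sub_cancel, ← two_mul, add_comm b r] at this
      linarith [hf.log_nonpos hr]
    · have := hf.log_anti (a := r + b) (b := 2 * r) (by positivity) (by linarith)
      linarith [hf.log_nonpos hb]
  refine ⟨(f (2 * r))⁻¹, inv_pos.2 (hf.pos _ (by positivity)), fun a b ha hb => ?_⟩
  have ha' := hf.pos a ha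
  have hb' := hf.pos b hb
  have hab' := hf.pos (a + b) (by positivity)
  have h2 := hf.pos (2 * r) (by positivity)
  rw [inv_mul_eq_div, le_div_iff₀ h2, ← Real.log_le_log_iff (by positivity) hab',
    Real.log_mul (by positivity) (by positivity), Real.log_mul (by positivity) (by positivity)]
  have hs := hshift b hb
  rcases le_or_gt r a with h | h
  · have := hg.add_le_add_endpoints (sub_nonneg.2 h) hb
    rw [add_sub_cancel] at this
    linarith [hf.log_nonpos hr]
  · have := hf.log_anti (a := a + b) (b := r + b) (by positivity) (by linarith)
    linarith [hf.log_nonpos ha]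

/-- A convex function lies above the prolongation of its chord over `[a, a + 1]`, so `log f` falls
at most linearly. -/
theorem exists_log_ge (hf : SubExpDecay f) :
    ∃ C : ℝ, 0 ≤ C ∧ ∀ᶠ r in atTop, -(C * r) ≤ Real.log (f r) := by
  obtain ⟨a, ha, hg⟩ := hf.exists_nonneg_logConvex
  have hC := hf.log_nonpos (r := a + 1) (by positivity)
  refine ⟨-Real.log (f (a + 1)), by linarith, ?_⟩
  filter_upwards [eventually_ge_atTop (a + 1)] with r hr
  have hL : 0 < r - a := by linarith
  have hL' : 0 ≤ r - a - 1 := by linarith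
  have h := hg.2 (x := a) (y := r) (mem_Ici.2 le_rfl) (mem_Ici.2 (by linarith))
    (div_nonneg hL' hL.le) (div_nonneg zero_le_one hL.le) (by field_simp; ring)
  have e : ((r - a - 1) / (r - a)) • a + (1 / (r - a)) • r = a + 1 := by
    simp only [smul_eq_mul]; field_simp; ring
  rw [e] at h
  simp only [smul_eq_mul] at h
  have h2 : (r - a) * Real.log (f (a + 1)) ≤ (r - a - 1) * Real.log (f a) + Real.log (f r) := by
    calc (r - a) * Real.log (f (a + 1)) ≤ (r - a) * _ := mul_le_mul_of_nonneg_left h hL.le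
      _ = _ := by field_simp
  have h3 := mul_nonpos_of_nonneg_of_nonpos hL' (hf.log_nonpos ha)
  have h4 := mul_nonpos_of_nonneg_of_nonpos ha hC
  linarith

/-- This is fast decay with `α = 3 / 4`. An exponent above `1 / 2` makes the bound superlinear in
`r`, so that it beats the linear lower bound on `log (f (r / 2))`. -/
theorem eventually_log_sq_le (hf : SubExpDecay f) :
    ∀ᶠ r in atTop, Real.log (f (r ^ 2)) ≤ -(r * √r) := by
  have h1 := (hf.fast (3 / 4) (by norm_num) (by norm_num)).eventually_lt_const zero_lt_one
  have h2 : Tendsto (fun r : ℝ => r ^ 2) atTop atTop := tendsto_pow_atTop two_ne_zero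
  filter_upwards [h2.eventually h1, eventually_gt_atTop 0] with r hr hr0
  have hp := hf.pos (r ^ 2) (by positivity)
  have h3 := Real.log_le_log (by positivity) hr.le
  rw [Real.log_mul (Real.exp_pos _).ne' hp.ne', Real.log_exp, Real.log_one] at h3
  have e : (r ^ 2) ^ (3 / 4 : ℝ) = r * √r := by
    rw [← Real.rpow_natCast_mul hr0.le, Real.sqrt_eq_rpow]
    nth_rewrite 2 [← Real.rpow_one r]
    rw [← Real.rpow_add hr0]
    norm_num
  rw [e] at h3
  linarith

/-- The graph of `log f` at `r` lies below the chord from `r / 2` to `r ^ 2`. That chord drops by at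
least `r (√r - C / 2)`, and `r` lies the fraction `1 / (2r - 1)` along it, which gives a drop of at
least `√r / 2 - C / 4`. -/
theorem eventually_log_add_le (hf : SubExpDecay f) :
    ∃ C : ℝ, ∀ᶠ r in atTop, Real.log (f r) ≤ Real.log (f (r / 2)) - √r / 2 + C := by
  obtain ⟨a, ha, hg⟩ := hf.exists_nonneg_logConvex
  obtain ⟨C, hC, hlow⟩ := hf.exists_log_ge
  have hhalf : Tendsto (fun r : ℝ => r / 2) atTop atTop := tendsto_id.atTop_div_const two_pos
  refine ⟨C / 4, ?_⟩
  filter_upwards [hf.eventually_log_sq_le, hhalf.eventually hlow, eventually_ge_atTop (2 * a),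
    eventually_ge_atTop 1, Real.tendsto_sqrt_atTop.eventually_ge_atTop C] with r h1 h2 hra hr1 hrC
  have hr0 : 0 < r := by linarith
  have hL : 0 < 2 * r - 1 := by linarith
  have h := hg.2 (x := r / 2) (y := r ^ 2) (mem_Ici.2 (by linarith)) (mem_Ici.2 (by nlinarith))
    (div_nonneg (by linarith : 0 ≤ 2 * r - 2) hL.le) (div_nonneg zero_le_one hL.le)
    (by field_simp; ring)
  have e : ((2 * r - 2) / (2 * r - 1)) • (r / 2) + (1 / (2 * r - 1)) • (r ^ 2) = r := by
    simp only [smul_eq_mul]; field_simp; ring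
  rw [e] at h
  simp only [smul_eq_mul] at h
  have h3 : Real.log (f r) ≤ Real.log (f (r / 2))
      + (Real.log (f (r ^ 2)) - Real.log (f (r / 2))) / (2 * r - 1) := by
    refine h.trans (le_of_eq ?_)
    field_simp
    ring
  have h4 : Real.log (f (r ^ 2)) - Real.log (f (r / 2)) ≤ r * (C / 2 - √r) := by linarith
  have h5 : (Real.log (f (r ^ 2)) - Real.log (f (r / 2))) / (2 * r - 1) ≤ (C / 2 - √r) / 2 := by
    rw [div_le_iff₀ hL]
    have h6 : C / 2 - √r ≤ 0 := by linarith
    nlinarith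
  linarith

/-- The gain `√r / 2` in the logarithm beats `m log (1 + r)` for large `r`; the bounded remaining
range goes into the constant. -/
theorem exists_mul_pow_le (hf : SubExpDecay f) (m : ℕ) :
    ∃ C : ℝ, 0 < C ∧ ∀ r : ℝ, 0 ≤ r → f r * (1 + r) ^ m ≤ C * f (r / 2) := by
  have hev : ∀ᶠ r in atTop, f r * (1 + r) ^ m ≤ f (r / 2) := by
    obtain ⟨C, hC⟩ := hf.eventually_log_add_le
    have hlog := (isLittleO_log_rpow_atTop (r := 1 / 2) (by norm_num)).bound
      (c := 1 / (4 * (m + 1))) (by positivity)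
    filter_upwards [hC, hlog, eventually_ge_atTop 1,
      Real.tendsto_sqrt_atTop.eventually_ge_atTop (4 * (C + m * Real.log 2))] with r h1 h2 h3 h4
    have hr0 : 0 < r := by linarith
    have hp := hf.pos r hr0.le
    have hp2 := hf.pos (r / 2) (by positivity)
    rw [← Real.log_le_log_iff (by positivity) hp2, Real.log_mul hp.ne' (by positivity),
      Real.log_pow]
    rw [← Real.sqrt_eq_rpow, Real.norm_of_nonneg (Real.log_nonneg h3),
      Real.norm_of_nonneg (Real.sqrt_nonneg r)] at h2
    have h5 : Real.log (1 + r) ≤ Real.log 2 + Real.log r := by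
      rw [← Real.log_mul two_ne_zero hr0.ne']
      exact Real.log_le_log (by positivity) (by linarith)
    have h6 : m * Real.log r ≤ √r / 4 := by
      calc m * Real.log r ≤ (m + 1) * (1 / (4 * (m + 1)) * √r) := by
            gcongr
            · exact Real.log_nonneg h3
            · linarith
        _ = √r / 4 := by field_simp
    have h7 : (m : ℝ) * Real.log (1 + r) ≤ m * (Real.log 2 + Real.log r) := by gcongr
    linarith
  obtain ⟨ρ, hρ⟩ := eventually_atTop.1 hev
  set ρ' := max ρ 0 with hρ'
  have hρ0 : 0 ≤ ρ' := le_max_right _ _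
  have hfρ := hf.pos ρ' hρ0
  refine ⟨1 + (1 + ρ') ^ m / f ρ', by positivity, fun r hr => ?_⟩
  have hp2 := hf.pos (r / 2) (by positivity)
  rcases le_or_gt ρ' r with h | h
  · refine (hρ r ((le_max_left _ _).trans h)).trans (le_mul_of_one_le_left hp2.le ?_)
    have : 0 ≤ (1 + ρ') ^ m / f ρ' := by positivity
    linarith
  · have h1 : f ρ' ≤ f (r / 2) :=
      hf.anti (mem_Ici.2 (by positivity)) (mem_Ici.2 hρ0) (by linarith)
    calc f r * (1 + r) ^ m ≤ 1 * (1 + ρ') ^ m := by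
          gcongr
          exact hf.le_one hr
      _ = (1 + ρ') ^ m / f ρ' * f ρ' := by field_simp
      _ ≤ (1 + ρ') ^ m / f ρ' * f (r / 2) := by gcongr
      _ ≤ _ := by gcongr; linarith

/-- Supermultiplicativity turns the shift by `r₀` into the constant factor `C₁ / f r₀`. -/
theorem exists_shift_mul_pow_le (hf : SubExpDecay f) (m r₀ : ℕ) :
    ∃ C : ℝ, 0 < C ∧ ∀ r : ℕ, r₀ ≤ r →
      f ((r : ℝ) - r₀) * (1 + r) ^ m ≤ C * f ((r : ℝ) / 2) := by
  obtain ⟨C₁, hC₁, h1⟩ := hf.exists_mul_le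
  obtain ⟨C₂, hC₂, h2⟩ := hf.exists_mul_pow_le m
  have h0 := hf.pos r₀ (by positivity)
  refine ⟨C₁ / f r₀ * C₂, by positivity, fun r hr => ?_⟩
  have h3 := h1 ((r : ℝ) - r₀) r₀ (sub_nonneg.2 (by exact_mod_cast hr)) (by positivity)
  rw [sub_add_cancel] at h3
  calc f ((r : ℝ) - r₀) * (1 + r) ^ m ≤ C₁ / f r₀ * f r * (1 + r) ^ m := by
        gcongr
        rw [div_mul_eq_mul_div, le_div_iff₀ h0]
        exact h3
    _ = C₁ / f r₀ * (f r * (1 + r) ^ m) := by ring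
    _ ≤ C₁ / f r₀ * (C₂ * f (r / 2)) := mul_le_mul_of_nonneg_left (h2 r (by positivity)) (by positivity)
    _ = _ := by ring

end SubExpDecay

/-! ### Geometry of the lattice -/

section Geometry

variable {d : ℕ} {Λ : Finset (Fin d → ℤ)}

theorem latDist_self (u : Λ) : latDist u u = 0 := SimpleGraph.edist_self

theorem latDist_comm (u v : Λ) : latDist u v = latDist v u := SimpleGraph.edist_comm

theorem latDist_triangle (u v z : Λ) : latDist u z ≤ latDist u v + latDist v z :=
  SimpleGraph.edist_triangle

theorem mem_latBall_comm {u v : Λ} {r : ℕ} : v ∈ latBall u r ↔ u ∈ latBall v r := by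
  simp only [latBall, mem_ofPred_eq, latDist_comm]

theorem latDist_le_of_mem_latBall {u x z : Λ} {r : ℕ} (hx : x ∈ latBall u r)
    (hz : z ∈ latBall u r) : latDist x z ≤ (2 * r : ℕ) := by
  refine (latDist_triangle x u z).trans ?_
  rw [two_mul, Nat.cast_add]
  exact add_le_add (by rw [latDist_comm]; exact hx) hz

theorem exists_walk_of_mem_latBall {u v : Λ} {r : ℕ} (h : v ∈ latBall u r) :
    ∃ p : (siteGraph Λ).Walk u v, p.length ≤ r := by
  have h' : (siteGraph Λ).edist u v ≤ r := h
  obtain ⟨p, hp⟩ := SimpleGraph.exists_walk_of_edist_ne_top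
    (ne_top_of_le_ne_top (ENat.natCast_ne_top r) h')
  rw [← hp] at h'
  exact ⟨p, by exact_mod_cast h'⟩

theorem abs_sub_le_length {u v : Λ} (p : (siteGraph Λ).Walk u v) (i : Fin d) :
    |u.1 i - v.1 i| ≤ p.length := by
  induction p with
  | nil => simp
  | @cons u w v h p ih =>
    have h1 : |u.1 i - w.1 i| ≤ 1 := by
      have h2 : ∑ j, |u.1 j - w.1 j| = 1 := h
      rw [← h2]
      exact Finset.single_le_sum (f := fun j => |u.1 j - w.1 j|) (fun _ _ => abs_nonneg _)
        (Finset.mem_univ i)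
    have h3 := abs_sub_le (u.1 i) (w.1 i) (v.1 i)
    rw [SimpleGraph.Walk.length_cons]
    push_cast
    linarith

open Classical in
-- Each step of a walk changes a coordinate by at most one, so the ball lies in a cube of side `2r +
-- 1`.
theorem card_latBall_le (u : Λ) (r : ℕ) :
    (Finset.univ.filter fun v => v ∈ latBall u r).card ≤ (2 * r + 1) ^ d := by
  have h : (Finset.univ.filter fun v => v ∈ latBall u r).card ≤
      (Fintype.piFinset fun i : Fin d => Finset.Icc (u.1 i - r) (u.1 i + r)).card := by
    refine Finset.card_le_card_of_injOn Subtype.val (fun v hv => ?_) Subtype.val_injective.injOn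
    obtain ⟨p, hp⟩ := exists_walk_of_mem_latBall (Finset.mem_filter.1 hv).2
    simp only [Finset.mem_coe, Fintype.mem_piFinset, Finset.mem_Icc]
    intro i
    have h1 := abs_le.1 (abs_sub_le_length p i)
    have h2 : (p.length : ℤ) ≤ r := by exact_mod_cast hp
    constructor <;> linarith [h1.1, h1.2]
  refine h.trans (le_of_eq ?_)
  rw [Fintype.card_piFinset]
  have h2 : ∀ i : Fin d, (Finset.Icc (u.1 i - r) (u.1 i + r)).card = 2 * r + 1 := by
    intro i
    rw [Int.card_Icc]
    omega
  simp [h2]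

/-- The walk crosses an edge between `A` and its complement, and the endpoint of that edge in `A`
belongs to `∂A`. -/
theorem exists_mem_bdry_of_walk {A : Set Λ} {u v : Λ} (p : (siteGraph Λ).Walk u v)
    (h : u ∈ A ↔ v ∉ A) : ∃ x ∈ bdry A, latDist u x ≤ p.length := by
  induction p with
  | nil => exact absurd h (by tauto)
  | @cons u w v hadj p ih =>
    have hone : latDist u w ≤ 1 := by
      have := SimpleGraph.edist_eq_one_iff_adj.2 hadj
      exact this.le
    rw [SimpleGraph.Walk.length_cons]
    by_cases hu : u ∈ A
    · by_cases hw : w ∈ A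
      · obtain ⟨x, hx, hd⟩ := ih (by tauto)
        refine ⟨x, hx, (latDist_triangle u w x).trans ?_⟩
        rw [add_comm, Nat.cast_add, Nat.cast_one]
        exact add_le_add hd hone
      · exact ⟨u, ⟨hu, w, hw, hadj⟩, by simp [latDist_self]⟩
    · by_cases hw : w ∈ A
      · refine ⟨w, ⟨hw, u, hu, hadj.symm⟩, hone.trans ?_⟩
        exact_mod_cast Nat.le_add_left 1 _
      · obtain ⟨x, hx, hd⟩ := ih (by tauto)
        refine ⟨x, hx, (latDist_triangle u w x).trans ?_⟩
        rw [add_comm, Nat.cast_add, Nat.cast_one]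
        exact add_le_add hd hone

/-- A ball which meets both `A` and its complement contains a point of `∂A`. -/
theorem latBall_inter_bdry_nonempty {A : Set Λ} {u : Λ} {r : ℕ} (h : ¬latBall u r ⊆ A)
    (h' : ¬latBall u r ⊆ Aᶜ) : (latBall u r ∩ bdry A).Nonempty := by
  obtain ⟨v, hv, hvA⟩ := not_subset.1 h
  obtain ⟨v', hv', hvA'⟩ := not_subset.1 h'
  rw [notMem_compl_iff] at hvA'
  have key : ∀ z ∈ latBall u r, (u ∈ A ↔ z ∉ A) → (latBall u r ∩ bdry A).Nonempty := by
    intro z hz hzA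
    obtain ⟨p, hp⟩ := exists_walk_of_mem_latBall hz
    obtain ⟨x, hx, hd⟩ := exists_mem_bdry_of_walk p hzA
    exact ⟨x, hd.trans (by exact_mod_cast hp), hx⟩
  by_cases hu : u ∈ A
  · exact key v hv (by tauto)
  · exact key v' hv' (by tauto)

theorem latDistSet_le (Y : Set Λ) (x z : Λ) : latDistSet z Y ≤ latDistSet x Y + latDist x z := by
  rw [latDistSet, latDistSet, ENat.iInf_add]
  refine le_iInf fun y => ?_
  rw [ENat.iInf_add]
  refine le_iInf fun hy => (iInf₂_le y hy).trans ?_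
  rw [add_comm, latDist_comm x z]
  exact latDist_triangle z x y

theorem latDistSet_eq_zero {Y : Set Λ} {x : Λ} (hx : x ∈ Y) : latDistSet x Y = 0 := by
  refine le_antisymm ((iInf₂_le x hx).trans ?_) zero_le
  rw [latDist_self]

theorem mem_bdryStrip {A : Set Λ} {R : ℕ} {x : Λ} :
    x ∈ bdryStrip A R ↔ latDistSet x (bdry A) ≤ R := by
  simp only [bdryStrip, innerStrip, outerStrip, mem_union, mem_ofPred_eq, mem_compl_iff]
  tauto

/-- The depth `max (L - d(x,Y)) 0` of a site in the `L`-neighbourhood of `Y`. -/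
def depth (Y : Set Λ) (L : ℕ) (x : Λ) : ℕ := ((L : ℕ∞) - latDistSet x Y).toNat

theorem coe_depth (Y : Set Λ) (L : ℕ) (x : Λ) : (depth Y L x : ℕ∞) = L - latDistSet x Y :=
  ENat.natCast_toNat (ne_top_of_le_ne_top (ENat.natCast_ne_top L) tsub_le_self)

theorem depth_eq_of_mem {Y : Set Λ} {L : ℕ} {x : Λ} (hx : x ∈ Y) : depth Y L x = L := by
  simp [depth, latDistSet_eq_zero hx]

theorem depth_eq_zero {Y : Set Λ} {L : ℕ} {x : Λ} (hx : ¬latDistSet x Y ≤ L) :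
    depth Y L x = 0 := by
  rw [depth, tsub_eq_zero_of_le (not_le.1 hx).le]
  rfl

theorem depth_le_add {Y : Set Λ} {L n : ℕ} {x z : Λ} (h : latDist x z ≤ n) :
    depth Y L x ≤ depth Y L z + n := by
  have h1 : (depth Y L x : ℕ∞) ≤ (depth Y L z + n : ℕ) := by
    rw [Nat.cast_add, coe_depth, coe_depth, tsub_le_iff_right]
    calc (L : ℕ∞) ≤ L - latDistSet z Y + latDistSet z Y := le_tsub_add
      _ ≤ L - latDistSet z Y + (latDistSet x Y + n) := by
          gcongr
          exact (latDistSet_le Y x z).trans (by gcongr)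
      _ = _ := by ring
  exact_mod_cast h1

end Geometry

/-! ### Algebras of local operators -/

section LocalAlgebra

open scoped Kronecker

variable {d : ℕ} {Λ : Finset (Fin d → ℤ)} {N : Λ → ℕ}

/-- Splitting a configuration into its parts inside and outside of `X`. -/
def splitConfig (N : Λ → ℕ) (X : Set Λ) :
    Config N ≃ ((u : X) → Fin (N u)) × ((u : (Xᶜ : Set Λ)) → Fin (N u)) :=
  open Classical in Equiv.piEquivPiSubtypeProd (· ∈ X) fun u => Fin (N u)

theorem extendOp_apply_of_eq {X : Set Λ} (B : Matrix ((u : X) → Fin (N u)) ((u : X) → Fin (N u)) ℂ)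
    {x y : Config N} (h : ∀ u, u ∉ X → x u = y u) :
    extendOp X B x y = B (fun u => x u) fun u => y u := by
  simp only [extendOp, Matrix.of_apply]
  exact if_pos h

theorem extendOp_apply_of_ne {X : Set Λ} (B : Matrix ((u : X) → Fin (N u)) ((u : X) → Fin (N u)) ℂ)
    {x y : Config N} (h : ¬∀ u, u ∉ X → x u = y u) : extendOp X B x y = 0 := by
  simp only [extendOp, Matrix.of_apply]
  exact if_neg h

open Classical in
-- As `B ⊗ 1`, local operators inherit products and commutation from the mixed-product rule.
theorem extendOp_eq_kronecker (X : Set Λ)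
    (B : Matrix ((u : X) → Fin (N u)) ((u : X) → Fin (N u)) ℂ) :
    extendOp X B = (B ⊗ₖ (1 : Matrix ((u : (Xᶜ : Set Λ)) → Fin (N u)) _ ℂ)).submatrix
      (splitConfig N X) (splitConfig N X) := by
  ext x y
  have h : (∀ u, u ∉ X → x u = y u) ↔
      (splitConfig N X x).2 = (splitConfig N X y).2 := by
    rw [funext_iff]
    exact ⟨fun h u => h u.1 u.2, fun h u hu => h ⟨u, hu⟩⟩
  rw [Matrix.submatrix_apply, Matrix.kroneckerMap_apply, Matrix.one_apply]
  by_cases hxy : ∀ u, u ∉ X → x u = y u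
  · rw [extendOp_apply_of_eq B hxy, if_pos (h.1 hxy), mul_one]
    rfl
  · rw [extendOp_apply_of_ne B hxy, if_neg (mt h.2 hxy), mul_zero]

open Classical in
theorem extendOp_compl_eq_kronecker (X : Set Λ)
    (B : Matrix ((u : (Xᶜ : Set Λ)) → Fin (N u)) ((u : (Xᶜ : Set Λ)) → Fin (N u)) ℂ) :
    extendOp Xᶜ B = ((1 : Matrix ((u : X) → Fin (N u)) _ ℂ) ⊗ₖ B).submatrix
      (splitConfig N X) (splitConfig N X) := by
  ext x y
  have h : (∀ u, u ∉ Xᶜ → x u = y u) ↔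
      (splitConfig N X x).1 = (splitConfig N X y).1 := by
    rw [funext_iff]
    exact ⟨fun h u => h u.1 fun hu => hu u.2, fun h u hu => h ⟨u, notMem_compl_iff.1 hu⟩⟩
  rw [Matrix.submatrix_apply, Matrix.kroneckerMap_apply, Matrix.one_apply]
  by_cases hxy : ∀ u, u ∉ Xᶜ → x u = y u
  · rw [extendOp_apply_of_eq B hxy, if_pos (h.1 hxy), one_mul]
    rfl
  · rw [extendOp_apply_of_ne B hxy, if_neg (mt h.2 hxy), zero_mul]

theorem SupportedOn.mul {X : Set Λ} {M M' : Op N} (h : SupportedOn X M) (h' : SupportedOn X M') :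
    SupportedOn X (M * M') := by
  classical
  obtain ⟨B, rfl⟩ := h
  obtain ⟨B', rfl⟩ := h'
  refine ⟨B * B', ?_⟩
  rw [extendOp_eq_kronecker, extendOp_eq_kronecker, extendOp_eq_kronecker,
    Matrix.submatrix_mul_equiv, ← Matrix.mul_kronecker_mul, one_mul]

theorem SupportedOn.add {X : Set Λ} {M M' : Op N} (h : SupportedOn X M) (h' : SupportedOn X M') :
    SupportedOn X (M + M') := by
  obtain ⟨B, rfl⟩ := h
  obtain ⟨B', rfl⟩ := h'
  refine ⟨B + B', ?_⟩
  ext x y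
  rw [Matrix.add_apply]
  by_cases h : ∀ u, u ∉ X → x u = y u
  · simp only [extendOp_apply_of_eq _ h, Matrix.add_apply]
  · simp only [extendOp_apply_of_ne _ h, add_zero]

theorem SupportedOn.star {X : Set Λ} {M : Op N} (h : SupportedOn X M) :
    SupportedOn X (star M) := by
  obtain ⟨B, rfl⟩ := h
  refine ⟨Bᴴ, ?_⟩
  ext x y
  rw [Matrix.star_apply]
  by_cases h : ∀ u, u ∉ X → x u = y u
  · rw [extendOp_apply_of_eq B fun u hu => (h u hu).symm, extendOp_apply_of_eq _ h]
    rfl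
  · rw [extendOp_apply_of_ne B fun h' => h fun u hu => (h' u hu).symm, extendOp_apply_of_ne _ h,
      star_zero]

theorem supportedOn_smul_one (X : Set Λ) (c : ℂ) : SupportedOn X (c • (1 : Op N)) := by
  classical
  refine ⟨c • 1, ?_⟩
  rw [extendOp_eq_kronecker, Matrix.smul_kronecker, Matrix.one_kronecker_one,
    Matrix.submatrix_smul, Pi.smul_apply, Pi.smul_apply, Matrix.submatrix_one_equiv]

theorem SupportedOn.mono {X Y : Set Λ} (hXY : X ⊆ Y) {M : Op N} (h : SupportedOn X M) :
    SupportedOn Y M := by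
  classical
  obtain ⟨B, rfl⟩ := h
  refine ⟨Matrix.of fun x y => if ∀ u : Y, u.1 ∉ X → x u = y u then
    B (fun u => x ⟨u, hXY u.2⟩) (fun u => y ⟨u, hXY u.2⟩) else 0, ?_⟩
  ext x y
  by_cases h : ∀ u, u ∉ X → x u = y u
  · rw [extendOp_apply_of_eq B h, extendOp_apply_of_eq _ fun u hu => h u fun hX => hu (hXY hX)]
    exact (if_pos fun (u : Y) hu => h u.1 hu).symm
  · rw [extendOp_apply_of_ne B h]
    by_cases h1 : ∀ u, u ∉ Y → x u = y u
    · rw [extendOp_apply_of_eq _ h1]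
      refine (if_neg fun h2 => h fun u hu => ?_).symm
      by_cases hY : u ∈ Y
      · exact h2 ⟨u, hY⟩ hu
      · exact h1 u hY
    · rw [extendOp_apply_of_ne _ h1]

theorem SupportedOn.commute_compl {X : Set Λ} {M M' : Op N} (h : SupportedOn X M)
    (h' : SupportedOn Xᶜ M') : M * M' = M' * M := by
  classical
  obtain ⟨B, rfl⟩ := h
  obtain ⟨B', rfl⟩ := h'
  rw [extendOp_eq_kronecker, extendOp_compl_eq_kronecker, Matrix.submatrix_mul_equiv,
    Matrix.submatrix_mul_equiv, ← Matrix.mul_kronecker_mul, ← Matrix.mul_kronecker_mul, one_mul, mul_one, one_mul, mul_one]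

/-- The ⋆-algebra of operators supported on `X`. -/
def localAlgebra (N : Λ → ℕ) (X : Set Λ) : StarSubalgebra ℂ (Op N) where
  carrier := {M | SupportedOn X M}
  mul_mem' := SupportedOn.mul
  add_mem' := SupportedOn.add
  algebraMap_mem' c := by
    rw [Algebra.algebraMap_eq_smul_one]
    exact supportedOn_smul_one X c
  star_mem' := SupportedOn.star

theorem isLocalNet_localAlgebra (N : Λ → ℕ) : IsLocalNet (localAlgebra N) where
  mono hXY _ h := SupportedOn.mono hXY h
  commute hXY _ ha _ hc := SupportedOn.commute_compl ha
    (SupportedOn.mono (subset_compl_iff_disjoint_left.2 hXY) hc)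

end LocalAlgebra

/-! ### Collecting the terms of an infinite family by their regions -/

section Grouping

open scoped Classical

variable {ι J : Type*} {𝔸 : Type*} [CStarAlgebra 𝔸]

/-- The sum of the terms of the family `g` whose region is `X`. -/
def groupBy {E : Type*} [AddCommMonoid E] [TopologicalSpace E] (reg : J → Set ι) (g : J → E)
    (X : Set ι) : E := ∑' p, if reg p = X then g p else 0

theorem summable_group {E : Type*} [NormedAddCommGroup E] [CompleteSpace E] {reg : J → Set ι}
    {g : J → E} {β : J → ℝ} (hβ : Summable β) (hg : ∀ p, ‖g p‖ ≤ β p) (X : Set ι) :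
    Summable fun p => if reg p = X then g p else 0 := by
  refine Summable.of_norm_bounded hβ fun p => ?_
  split_ifs
  · exact hg p
  · simpa using (norm_nonneg _).trans (hg p)

theorem isInteraction_groupBy [FiniteDimensional ℂ 𝔸] {𝓛 : Set ι → StarSubalgebra ℂ 𝔸}
    {reg : J → Set ι} {D : J → ℝ → 𝔸} {β : J → ℝ} (hβ : Summable β)
    (hherm : ∀ p, ∀ t ∈ Icc (0 : ℝ) 1, star (D p t) = D p t)
    (hcont : ∀ p, ContinuousOn (D p) (Icc 0 1))
    (hmem : ∀ p, ∀ t ∈ Icc (0 : ℝ) 1, D p t ∈ 𝓛 (reg p))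
    (hnorm : ∀ p, ∀ t ∈ Icc (0 : ℝ) 1, ‖D p t‖ ≤ β p) :
    IsInteraction 𝓛 (fun X t => groupBy reg (fun p => D p t) X) (groupBy reg β) := by
  have hβ0 : ∀ p, 0 ≤ β p := fun p => (norm_nonneg _).trans (hnorm p 0 (by simp))
  refine ⟨fun X t ht => ?_, fun X => ?_, fun X t ht => ?_, fun X t ht => ?_⟩
  · rw [groupBy, tsum_star]
    refine tsum_congr fun p => ?_
    split_ifs
    · exact hherm p t ht
    · exact star_zero _
  · refine continuousOn_tsum (u := β) (fun p => ?_) hβ fun p t ht => ?_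
    · split_ifs
      · exact hcont p
      · exact continuousOn_const
    · split_ifs
      · exact hnorm p t ht
      · simpa using hβ0 p
  -- Finite-dimensional subspaces are closed, so an infinite sum of local terms is local.
  · have hcl : IsClosed ((𝓛 X).toSubalgebra.toSubmodule : Set 𝔸) :=
      Submodule.closed_of_finiteDimensional _
    refine hcl.mem_of_tendsto (summable_group hβ (fun p => hnorm p t ht) X).hasSum
      (Eventually.of_forall fun F => ?_)
    refine Submodule.sum_mem _ fun p _ => ?_
    split_ifs with h
    · exact h ▸ hmem p t ht
    · exact Submodule.zero_mem _
  · refine tsum_of_norm_bounded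
      (summable_group hβ (fun p => (Real.norm_of_nonneg (hβ0 p)).le) X).hasSum fun p => ?_
    split_ifs
    · exact hnorm p t ht
    · simp

theorem sum_groupBy {E : Type*} [NormedAddCommGroup E] [CompleteSpace E] {reg : J → Set ι}
    {g : J → E} {β : J → ℝ} (hβ : Summable β) (hg : ∀ p, ‖g p‖ ≤ β p) (S : Finset (Set ι)) :
    ∑ X ∈ S, groupBy reg g X = ∑' p, if reg p ∈ S then g p else 0 := by
  simp only [groupBy]
  rw [← Summable.tsum_finsetSum fun X _ => summable_group hβ hg X]
  exact tsum_congr fun p => by rw [Finset.sum_ite_eq]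

theorem sum_groupBy_mul {reg : J → Set ι} {β : J → ℝ} (hβ : Summable β) (hβ0 : ∀ p, 0 ≤ β p)
    (v : Set ι → ℝ) (S : Finset (Set ι)) :
    ∑ X ∈ S, groupBy reg β X * v X = ∑' p, if reg p ∈ S then β p * v (reg p) else 0 := by
  have hs : ∀ X, Summable fun p => (if reg p = X then β p else 0) * v X := fun X =>
    (summable_group hβ (fun p => (Real.norm_of_nonneg (hβ0 p)).le) X).mul_right _
  simp only [groupBy, ← tsum_mul_right]
  rw [← Summable.tsum_finsetSum fun X _ => hs X]
  refine tsum_congr fun p => ?_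
  simp only [ite_mul, zero_mul]
  rw [Finset.sum_ite_eq]

end Grouping

/-! ### The interaction of a quasi-adiabatic evolution -/

section Weights

variable {d : ℕ} {Λ : Finset (Fin d → ℤ)} {r₀ : ℕ}

/-- The ball belonging to an index of the local terms. -/
def indexBall (p : Λ × {r : ℕ // r₀ ≤ r}) : Set Λ := latBall p.1 p.2

/-- The weight which is small close to `Y` and one at distance `L` from `Y`. -/
def depthWeight (f : ℝ → ℝ) (Y : Set Λ) (L : ℕ) (x : Λ) : ℝ := f ((depth Y L x : ℝ) / 4)

theorem summable_inv_sq (r₀ : ℕ) :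
    Summable fun r : {r : ℕ // r₀ ≤ r} => ((1 + (r.1 : ℝ)) ^ 2)⁻¹ := by
  have h1 : Summable fun r : ℕ => (((r + 1 : ℕ) : ℝ) ^ 2)⁻¹ :=
    (summable_nat_add_iff 1).2 (Real.summable_nat_pow_inv.2 one_lt_two)
  refine (h1.comp_injective Subtype.val_injective).congr fun r => ?_
  simp [add_comm]

theorem summable_index_of_le {β : Λ × {r : ℕ // r₀ ≤ r} → ℝ} {C : ℝ}
    (h0 : ∀ p, 0 ≤ β p) (h : ∀ p, β p ≤ C * ((1 + (p.2.1 : ℝ)) ^ 2)⁻¹) : Summable β := by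
  refine Summable.of_nonneg_of_le h0 h (Summable.mul_left C ?_)
  have h1 : Summable fun _ : Λ => (1 : ℝ) := Summable.of_finite
  simpa using h1.mul_of_nonneg (summable_inv_sq r₀) (fun _ => zero_le_one)
    (fun r => by positivity)

open Classical in
-- At most `(2r + 1) ^ d` centres have `x` in their ball of radius `r`; this consumes `d` of the
-- powers and leaves a convergent series.
theorem tsum_index_mem_le (x : Λ) :
    ∑' p : Λ × {r : ℕ // r₀ ≤ r},
        (if x ∈ indexBall p then ((1 + (p.2.1 : ℝ)) ^ (d + 2))⁻¹ else 0)
      ≤ 2 ^ d * ∑' r : {r : ℕ // r₀ ≤ r}, ((1 + (r.1 : ℝ)) ^ 2)⁻¹ := by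
  set g : Λ → {r : ℕ // r₀ ≤ r} → ℝ := fun u r =>
    if x ∈ latBall u r then ((1 + (r.1 : ℝ)) ^ (d + 2))⁻¹ else 0 with hg
  have hg0 : ∀ u r, 0 ≤ g u r := by
    intro u r
    simp only [hg]
    split_ifs <;> positivity
  have hgle : ∀ u r, g u r ≤ ((1 + (r.1 : ℝ)) ^ 2)⁻¹ := by
    intro u r
    simp only [hg]
    split_ifs
    · gcongr
      · linarith [(Nat.cast_nonneg r.1 : (0 : ℝ) ≤ r.1)]
      · omega
    · positivity
  have hs : Summable fun p : Λ × {r : ℕ // r₀ ≤ r} => g p.1 p.2 :=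
    summable_index_of_le (C := 1) (fun p => hg0 _ _) fun p => by simpa using hgle p.1 p.2
  have hs' : ∀ u, Summable (g u) := fun u =>
    Summable.of_nonneg_of_le (hg0 u) (hgle u) (summable_inv_sq r₀)
  change ∑' p : Λ × {r : ℕ // r₀ ≤ r}, g p.1 p.2 ≤ _
  rw [hs.tsum_prod, tsum_fintype, ← Summable.tsum_finsetSum fun u _ => hs' u, ← tsum_mul_left]
  refine Summable.tsum_le_tsum (fun r => ?_) (summable_sum fun u _ => hs' u)
    ((summable_inv_sq r₀).mul_left _)
  have hcard : ((Finset.univ.filter fun u => x ∈ latBall u r).card : ℝ)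
      ≤ (2 * (1 + (r.1 : ℝ))) ^ d := by
    have h1 := card_latBall_le x r.1
    simp only [mem_latBall_comm (u := x)] at h1
    have h2 : (((2 * r.1 + 1) ^ d : ℕ) : ℝ) ≤ (2 * (1 + (r.1 : ℝ))) ^ d := by
      push_cast
      gcongr
      linarith
    exact le_trans (by exact_mod_cast h1) h2
  calc ∑ u, g u r
      = (Finset.univ.filter fun u => x ∈ latBall u r).card * ((1 + (r.1 : ℝ)) ^ (d + 2))⁻¹ := by
        simp only [hg]
        rw [← Finset.sum_filter, Finset.sum_const, nsmul_eq_mul]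
    _ ≤ (2 * (1 + (r.1 : ℝ))) ^ d * ((1 + (r.1 : ℝ)) ^ (d + 2))⁻¹ := by gcongr
    _ = 2 ^ d * ((1 + (r.1 : ℝ)) ^ 2)⁻¹ := by
        rw [mul_pow, pow_add]
        field_simp

open Classical in
-- Depths within the ball differ by at most its diameter `2r`. In the scale `depth / 4` this is `r /
-- 2`, which the factor `f (r / 2)` pays for by supermultiplicativity.
theorem setWeight_latBall_le {f : ℝ → ℝ} (hf : SubExpDecay f) {C : ℝ} (hC : 0 < C)
    (hmul : ∀ a b : ℝ, 0 ≤ a → 0 ≤ b → f a * f b ≤ C * f (a + b)) (Y : Set Λ) (L r : ℕ)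
    {u x : Λ} (hx : x ∈ latBall u r) :
    f ((r : ℝ) / 2) * setWeight (depthWeight f Y L) (latBall u r)
      ≤ (2 * (1 + (r : ℝ))) ^ d * (C * depthWeight f Y L x) := by
  have hr := hf.pos ((r : ℝ) / 2) (by positivity)
  have hx0 := hf.pos ((depth Y L x : ℝ) / 4) (by positivity)
  have hz : ∀ z ∈ latBall u r,
      f ((r : ℝ) / 2) * depthWeight f Y L z ≤ C * depthWeight f Y L x := by
    intro z hz
    have h1 := depth_le_add (Y := Y) (L := L) (latDist_le_of_mem_latBall hx hz)
    have h2 : (depth Y L x : ℝ) ≤ depth Y L z + 2 * r := by exact_mod_cast h1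
    refine (hmul _ _ (by positivity) (by positivity)).trans
      (mul_le_mul_of_nonneg_left (hf.anti ?_ ?_ ?_) hC.le)
    · exact mem_Ici.2 (by positivity)
    · exact mem_Ici.2 (by positivity)
    · linarith
  have hcard : ((Finset.univ.filter fun z => z ∈ latBall u r).card : ℝ)
      ≤ (2 * (1 + (r : ℝ))) ^ d := by
    have h1 := card_latBall_le u r
    have h2 : (((2 * r + 1) ^ d : ℕ) : ℝ) ≤ (2 * (1 + (r : ℝ))) ^ d := by
      push_cast
      gcongr
      linarith
    exact le_trans (by exact_mod_cast h1) h2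
  calc f ((r : ℝ) / 2) * setWeight (depthWeight f Y L) (latBall u r)
      = ∑ z with z ∈ latBall u r, f ((r : ℝ) / 2) * depthWeight f Y L z := by
        rw [← Finset.mul_sum, setWeight, Finset.sum_filter]
        rfl
    _ ≤ ∑ z with z ∈ latBall u r, C * depthWeight f Y L x :=
        Finset.sum_le_sum fun z h => hz z (Finset.mem_filter.1 h).2
    _ = (Finset.univ.filter fun z => z ∈ latBall u r).card * (C * depthWeight f Y L x) := by
        rw [Finset.sum_const, nsmul_eq_mul]
    _ ≤ _ := mul_le_mul_of_nonneg_right hcard (mul_nonneg hC.le hx0.le)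

open Classical in
theorem exists_isTransportWeight (d r₀ : ℕ) {f : ℝ → ℝ} (hf : SubExpDecay f) :
    ∃ κ : ℝ, 0 < κ ∧ ∀ (Λ : Finset (Fin d → ℤ)) (J₂ : ℝ), 0 ≤ J₂ →
      Summable (fun p : Λ × {r : ℕ // r₀ ≤ r} => 2 * J₂ * f ((p.2.1 : ℝ) - r₀)) ∧
      ∀ (Y : Set Λ) (L : ℕ), IsTransportWeight
        (groupBy indexBall fun p : Λ × {r : ℕ // r₀ ≤ r} => 2 * J₂ * f ((p.2.1 : ℝ) - r₀))
        (depthWeight f Y L) (κ * J₂) := by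
  -- Of the power `2 * d + 2`, `d` pays for the sites of a ball, `d` for the centres of balls
  -- through `x`, and 2 for the sum over radii.
  obtain ⟨C₁, hC₁, h1⟩ := hf.exists_shift_mul_pow_le (2 * d + 2) r₀
  obtain ⟨C₂, hC₂, h2⟩ := hf.exists_mul_le
  set K : ℝ := ∑' r : {r : ℕ // r₀ ≤ r}, ((1 + (r.1 : ℝ)) ^ 2)⁻¹ with hK
  have hK0 : 0 ≤ K := tsum_nonneg fun r => by positivity
  -- `K + 1` in place of `K` makes the constant visibly positive.
  refine ⟨2 * C₁ * 2 ^ d * C₂ * (2 ^ d * (K + 1)), by positivity, fun Λ J₂ hJ => ?_⟩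
  set β : Λ × {r : ℕ // r₀ ≤ r} → ℝ := fun p => 2 * J₂ * f ((p.2.1 : ℝ) - r₀) with hβ
  have hβ0 : ∀ p, 0 ≤ β p := fun p => by
    have := hf.pos ((p.2.1 : ℝ) - r₀) (sub_nonneg.2 (by exact_mod_cast p.2.2))
    positivity
  have hβle : ∀ p, β p ≤
      2 * J₂ * C₁ * ((1 + (p.2.1 : ℝ)) ^ (2 * d + 2))⁻¹ * f ((p.2.1 : ℝ) / 2) := by
    intro p
    have h3 := h1 p.2.1 p.2.2
    rw [← le_div_iff₀ (by positivity)] at h3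
    calc β p ≤ 2 * J₂ * (C₁ * f ((p.2.1 : ℝ) / 2) / (1 + (p.2.1 : ℝ)) ^ (2 * d + 2)) :=
          mul_le_mul_of_nonneg_left h3 (by positivity)
      _ = _ := by ring
  have hsum : Summable β := by
    refine summable_index_of_le (C := 2 * J₂ * C₁) hβ0 fun p => (hβle p).trans ?_
    have h3 := hf.le_one (r := (p.2.1 : ℝ) / 2) (by positivity)
    refine (mul_le_of_le_one_right (by positivity) h3).trans ?_
    gcongr
    · linarith [(Nat.cast_nonneg p.2.1 : (0 : ℝ) ≤ p.2.1)]
    · omega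
  refine ⟨hsum, fun Y L x => ?_⟩
  rw [sum_groupBy_mul hsum hβ0]
  have hx0 : 0 < depthWeight f Y L x := hf.pos _ (by positivity)
  have hterm : ∀ p : Λ × {r : ℕ // r₀ ≤ r},
      (if indexBall p ∈ Finset.univ.filter (fun X : Set Λ => x ∈ X) then
        β p * setWeight (depthWeight f Y L) (indexBall p) else 0)
      ≤ 2 * J₂ * C₁ * 2 ^ d * C₂ * depthWeight f Y L x *
        (if x ∈ indexBall p then ((1 + (p.2.1 : ℝ)) ^ (d + 2))⁻¹ else 0) := by
    intro p
    simp only [Finset.mem_filter, Finset.mem_univ, true_and]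
    split_ifs with hx
    · have hW : 0 ≤ setWeight (depthWeight f Y L) (indexBall p) :=
        setWeight_nonneg (fun z => hf.pos _ (by positivity)) _
      calc β p * setWeight (depthWeight f Y L) (indexBall p)
          ≤ 2 * J₂ * C₁ * ((1 + (p.2.1 : ℝ)) ^ (2 * d + 2))⁻¹ * f ((p.2.1 : ℝ) / 2)
            * setWeight (depthWeight f Y L) (indexBall p) :=
            mul_le_mul_of_nonneg_right (hβle p) hW
        _ = 2 * J₂ * C₁ * ((1 + (p.2.1 : ℝ)) ^ (2 * d + 2))⁻¹ * (f ((p.2.1 : ℝ) / 2)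
            * setWeight (depthWeight f Y L) (latBall p.1 p.2)) := by
            rw [mul_assoc _ (f _)]; rfl
        _ ≤ 2 * J₂ * C₁ * ((1 + (p.2.1 : ℝ)) ^ (2 * d + 2))⁻¹ *
            ((2 * (1 + (p.2.1 : ℝ))) ^ d * (C₂ * depthWeight f Y L x)) :=
            mul_le_mul_of_nonneg_left (setWeight_latBall_le hf hC₂ h2 Y L p.2.1 hx) (by positivity)
        _ = _ := by
            rw [mul_pow, show 2 * d + 2 = d + (d + 2) by ring, pow_add _ d (d + 2)]
            field_simp
    · simp
  have hsM : Summable fun p : Λ × {r : ℕ // r₀ ≤ r} =>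
      if x ∈ indexBall p then ((1 + (p.2.1 : ℝ)) ^ (d + 2))⁻¹ else 0 := by
    refine summable_index_of_le (C := 1) (fun p => ?_) fun p => ?_
    · split_ifs <;> positivity
    · rw [one_mul]
      split_ifs
      · gcongr
        · linarith [(Nat.cast_nonneg p.2.1 : (0 : ℝ) ≤ p.2.1)]
        · omega
      · positivity
  refine (Summable.tsum_le_tsum hterm (Summable.of_nonneg_of_le (fun p => ?_) hterm
    (hsM.mul_left _)) (hsM.mul_left _)).trans ?_
  · split_ifs
    · exact mul_nonneg (hβ0 p) (setWeight_nonneg (fun z => hf.pos _ (by positivity)) _)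
    · exact le_rfl
  · rw [tsum_mul_left]
    calc _ ≤ 2 * J₂ * C₁ * 2 ^ d * C₂ * depthWeight f Y L x * (2 ^ d * K) :=
          mul_le_mul_of_nonneg_left (tsum_index_mem_le x) (by positivity)
      _ ≤ 2 * J₂ * C₁ * 2 ^ d * C₂ * depthWeight f Y L x * (2 ^ d * (K + 1)) := by
          gcongr
          linarith
      _ = _ := by ring

end Weights

/-! ### Application to quasi-adiabatic evolutions -/

section Main

variable {d : ℕ} {Λ : Finset (Fin d → ℤ)} {N : Λ → ℕ} {r₀ : ℕ} {J₁ J₂ γ : ℝ}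
  {P : GappedPath Λ N r₀ J₁ J₂ γ} {f : ℝ → ℝ}

/-- The interaction of a quasi-adiabatic evolution: the sum of the local terms on a given ball. -/
def QuasiAdiabaticEvolution.interaction (𝒰 : QuasiAdiabaticEvolution P f) (X : Set Λ) (t : ℝ) :
    Op N :=
  groupBy indexBall (fun p : Λ × {r : ℕ // r₀ ≤ r} => 𝒰.D p.1 p.2 t) X

theorem QuasiAdiabaticEvolution.isInteraction (𝒰 : QuasiAdiabaticEvolution P f)
    (hs : Summable fun p : Λ × {r : ℕ // r₀ ≤ r} => 2 * J₂ * f ((p.2.1 : ℝ) - r₀)) :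
    IsInteraction (localAlgebra N) 𝒰.interaction
      (groupBy indexBall fun p : Λ × {r : ℕ // r₀ ≤ r} => 2 * J₂ * f ((p.2.1 : ℝ) - r₀)) :=
  isInteraction_groupBy hs (fun p t ht => 𝒰.D_herm p.1 p.2 p.2.2 t ht)
    (fun p => 𝒰.D_cont p.1 p.2 p.2.2) (fun p t ht => 𝒰.D_supp p.1 p.2 p.2.2 t ht)
    (fun p t ht => 𝒰.D_norm p.1 p.2 p.2.2 t ht)

theorem QuasiAdiabaticEvolution.isUnitaryEvolution (𝒰 : QuasiAdiabaticEvolution P f)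
    (hs : Summable fun p : Λ × {r : ℕ // r₀ ≤ r} => 2 * J₂ * f ((p.2.1 : ℝ) - r₀)) :
    IsUnitaryEvolution (partialGen 𝒰.interaction Finset.univ) 𝒰.U := by
  refine ⟨𝒰.U_zero, 𝒰.U_unitary, fun t ht => ?_⟩
  have h : partialGen 𝒰.interaction Finset.univ t = 𝒰.G t := by
    have h1 := sum_groupBy (reg := indexBall)
      (g := fun p : Λ × {r : ℕ // r₀ ≤ r} => 𝒰.D p.1 p.2 t) hs
      (fun p => 𝒰.D_norm p.1 p.2 p.2.2 t ht) Finset.univ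
    simp only [Finset.mem_univ, if_true] at h1
    exact h1.trans (𝒰.G_sum t ht).tsum_eq
  rw [h]
  exact 𝒰.U_deriv t ht

theorem groupBy_indexBall_ne_zero {β : Λ × {r : ℕ // r₀ ≤ r} → ℝ} {X : Set Λ}
    (h : groupBy indexBall β X ≠ 0) : ∃ (u : Λ) (r : ℕ), latBall u r = X := by
  by_contra! hX
  refine h ?_
  rw [groupBy]
  refine (tsum_congr fun (p : Λ × {r : ℕ // r₀ ≤ r}) => if_neg (hX p.1 p.2.1)).trans tsum_zero

theorem setWeight_depthWeight_self (f : ℝ → ℝ) (Y : Set Λ) (L : ℕ) :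
    setWeight (depthWeight f Y L) Y = Y.ncard * f ((L : ℝ) / 4) := by
  classical
  rw [setWeight, Set.ncard_eq_toFinset_card', ← nsmul_eq_mul, ← Finset.sum_const]
  rw [← Finset.sum_filter_of_ne (p := (· ∈ Y)) fun x _ hx => mem_of_indicator_ne_zero hx]
  refine Finset.sum_congr (by ext; simp) fun x hx => ?_
  have hxY : x ∈ Y := by simpa using hx
  rw [indicator_of_mem hxY, depthWeight, depth_eq_of_mem hxY]

theorem supportedOn_of_isEmpty [IsEmpty Λ] (X : Set Λ) (M : Op N) : SupportedOn X M := by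
  refine ⟨Matrix.of fun _ _ => M (fun u => isEmptyElim u) (fun u => isEmptyElim u), ?_⟩
  ext x y
  rw [extendOp_apply_of_eq _ fun u => isEmptyElim u, Matrix.of_apply]
  congr 1 <;> exact Subsingleton.elim _ _

end Main

end

theorem lemma1 (d : ℕ) :
    ∃ c₃ : ℝ, 0 < c₃ ∧
    ∀ (r₀ : ℕ) (γ : ℝ) (f : ℝ → ℝ), 0 < γ → SubExpDecay f →
    ∃ c₁ c₂ : ℝ, 0 < c₁ ∧ 0 < c₂ ∧
    ∀ (J₁ J₂ : ℝ) (Λ : Finset (Fin d → ℤ)) (N : Λ → ℕ)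
      (P : GappedPath Λ N r₀ J₁ J₂ γ) (𝒰 : QuasiAdiabaticEvolution P f)
      (A : Set Λ) (s : ℝ), s ∈ Set.Icc (0 : ℝ) 1 →
    ∃ UA UAc : Op N,
      UA ∈ Matrix.unitaryGroup (Config N) ℂ ∧ SupportedOn A UA ∧
      UAc ∈ Matrix.unitaryGroup (Config N) ℂ ∧ SupportedOn Aᶜ UAc ∧
      ∀ R : ℕ, ∃ UB : Op N,
        UB ∈ Matrix.unitaryGroup (Config N) ℂ ∧ SupportedOn (bdryStrip A (2 * R)) UB ∧
        ‖UA * UAc * UB - 𝒰.U s‖ ≤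
          c₁ * (Real.exp (c₂ * (J₂ / γ) * |s|) - 1) * ((bdry A).ncard : ℝ) * f (c₃ * R) := by
  -- The depth on `∂A` is `2R` and the weight is `f (depth / 4)`, hence `f (R / 2)`.
  refine ⟨1 / 2, by norm_num, fun r₀ γ f hγ hf => ?_⟩
  obtain ⟨κ, hκ, hT⟩ := exists_isTransportWeight d r₀ hf
  -- The factor `γ` cancels the one in `J₂ / γ`, since the transport constant is `κ * J₂`.
  refine ⟨1 / 4, 4 * κ * γ, by norm_num, by positivity, fun J₁ J₂ Λ N P 𝒰 A s hs => ?_⟩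
  -- Nonnegativity of `J₂` is read off from a local term, which requires a site. Without sites the
  -- boundary is empty and `𝒰.U s` itself serves as boundary unitary, with zero error.
  rcases isEmpty_or_nonempty Λ with hΛ | ⟨⟨u⟩⟩
  · refine ⟨1, 1, one_mem _, supportedOn_of_isEmpty _ _, one_mem _, supportedOn_of_isEmpty _ _,
      fun R => ⟨𝒰.U s, 𝒰.U_unitary s hs, supportedOn_of_isEmpty _ _, ?_⟩⟩
    simp [Set.eq_empty_of_isEmpty (bdry A)]
  have hJ : 0 ≤ J₂ := by
    have h := (norm_nonneg _).trans (𝒰.D_norm u r₀ le_rfl 0 (by simp))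
    rw [sub_self, hf.zero] at h
    linarith
  obtain ⟨hsum, hT⟩ := hT Λ J₂ hJ
  obtain ⟨UA, UAc, hUA, hUAm, hUAc, hUAcm, hfac⟩ :=
    exists_approx_factorization (isLocalNet_localAlgebra N) (𝒰.isInteraction hsum)
      (𝒰.isUnitaryEvolution hsum) A (bdry A) fun X hX h h' => by
        obtain ⟨v, r, rfl⟩ := groupBy_indexBall_ne_zero hX
        exact latBall_inter_bdry_nonempty h h'
  refine ⟨UA s, UAc s, hUA s hs, hUAm s, hUAc s hs, hUAcm s, fun R => ?_⟩
  obtain ⟨UB, hUB, hUBm, hle⟩ := hfac (bdryStrip A (2 * R)) (depthWeight f (bdry A) (2 * R))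
    (κ * J₂) (by positivity) (fun x => hf.pos _ (by positivity))
    (fun x hx => by
      rw [depthWeight, depth_eq_zero (mt mem_bdryStrip.2 hx)]
      simp [hf.zero])
    (hT (bdry A) (2 * R))
  refine ⟨UB s, hUB s hs, hUBm s, (hle s hs).trans (le_of_eq ?_)⟩
  rw [setWeight_depthWeight_self, abs_of_nonneg hs.1, ← mul_assoc,
    show 4 * κ * γ * (J₂ / γ) * s = 4 * (κ * J₂) * s by field_simp,
    show ((2 * R : ℕ) : ℝ) / 4 = 1 / 2 * R by push_cast; ring]
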